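/- All graphs are finite and simple. For a graph $X$ with vertex coloring $c$, let $\mathrm{Qut}_c(X)$ be its quantum automorphism group: the compact matrix quantum group whose algebra $C(\mathrm{Qut}_c(X))$ is the universal unital $C^*$-algebra with generators $u_{ij}$ ($i,j\in V(X)$) and relations $u_{ij}=u_{ij}^*=u_{ij}^2$, $\sum_k u_{ik}=1=\sum_k u_{kj}$, $u_{ij}u_{kl}=0$ if exactly one of $ik\in E(X)$, $jl\in E(X)$ holds, and $u_{ij}=0$ if $c(i)\ne c(j)$, with comultiplication $\Delta(u_{ij})=\sum_k u_{ik}\otimes u_{kj}$ (values in the minimal tensor product). Write $\mathrm{Qut}(X)$ if all vertices have the same color, and $\mathrm{Qut}_r(T)$ for a rooted tree $(T,r)$ in which the root has one color and all other vertices have a second color. Quantum groups are isomorphic ($\cong$) if there is a $*$-isomorphism of their $C^*$-algebras that intertwines the comultiplications. **Lemma.** For every rooted tree $(T,r)$ there is an (unrooted) tree $T'$ with $\mathrm{Qut}(T')\cong\mathrm{Qut}_r(T)$. More precisely: 1. If $T$ is a path rooted at one of its endpoints (the one-vertex tree included), then $\mathrm{Qut}(K_1)\cong\mathrm{Qut}_r(T)$,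 so one may take $T'=K_1$. 2. Otherwise one may take for $T'$ the tree obtained from the disjoint union of $T$ and a path $P$ with $2|V(T)|$ edges by adding one new vertex, adjacent to exactly $r$ and one endpoint of $P$; that is, this $T'$ is a tree and $\mathrm{Qut}(T')\cong\mathrm{Qut}_r(T)$. -/

import Mathlib

open scoped TensorProduct

universe u v

/-- A C*-seminorm on a unital *-algebra over `ℂ`: a submultiplicative seminorm satisfying the
C*-inequality. -/
structure CStarSeminorm (P : Type u) [Ring P] [StarRing P] [Algebra ℂ P] extends
    Seminorm ℂ P where
  mul_le' : ∀ x y, toFun (x * y) ≤ toFun x * toFun y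
  sq_le' : ∀ x, toFun x ^ 2 ≤ toFun (star x * x)

namespace CStarSeminorm

section Basic

variable {P : Type u} [Ring P] [StarRing P] [Algebra ℂ P]

instance : FunLike (CStarSeminorm P) P ℝ where
  coe p := p.toFun
  coe_injective := by
    rintro ⟨p, _, _⟩ ⟨q, _, _⟩ h
    have : p = q := DFunLike.coe_injective h
    subst this
    rfl

instance : SeminormClass (CStarSeminorm P) ℂ P where
  map_zero p := p.toSeminorm.map_zero'
  map_add_le_add p := p.toSeminorm.add_le'
  map_neg_eq_map p := p.toSeminorm.neg'
  map_smul_eq_mul p := p.toSeminorm.smul'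

theorem mul_le (p : CStarSeminorm P) (x y : P) : p (x * y) ≤ p x * p y := p.mul_le' x y

theorem sq_le (p : CStarSeminorm P) (x : P) : p x ^ 2 ≤ p (star x * x) := p.sq_le' x

theorem nonneg (p : CStarSeminorm P) (x : P) : 0 ≤ p x := apply_nonneg p x

theorem le_star (p : CStarSeminorm P) (x : P) : p x ≤ p (star x) := by
  rcases (p.nonneg x).eq_or_lt with h | h
  · rw [← h]; exact p.nonneg _
  · have := (p.sq_le x).trans (p.mul_le _ _)
    nlinarith

theorem map_star (p : CStarSeminorm P) (x : P) : p (star x) = p x :=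
  le_antisymm (by simpa using p.le_star (star x)) (p.le_star x)

/-- The pointwise supremum of a pointwise bounded set of C*-seminorms. -/
noncomputable def sup (S : Set (CStarSeminorm P))
    (hS : ∀ x, BddAbove ((fun p : CStarSeminorm P => p x) '' S)) : CStarSeminorm P :=
  have nn : ∀ x, 0 ≤ sSup ((fun p : CStarSeminorm P => p x) '' S) := fun x =>
    Real.sSup_nonneg (by rintro _ ⟨p, _, rfl⟩; exact p.nonneg x)
  have le : ∀ p ∈ S, ∀ x, p x ≤ sSup ((fun p : CStarSeminorm P => p x) '' S) :=
    fun p hp x => le_csSup (hS x) ⟨p, hp, rfl⟩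
  { Seminorm.of (fun x => sSup ((fun p : CStarSeminorm P => p x) '' S))
      (fun x y => Real.sSup_le (by
        rintro _ ⟨p, hp, rfl⟩
        exact (map_add_le_add p x y).trans (add_le_add (le p hp x) (le p hp y)))
        (add_nonneg (nn x) (nn y)))
      (fun a x => by
        rw [← smul_eq_mul, ← Real.sSup_smul_of_nonneg (norm_nonneg a), ← Set.image_smul,
          Set.image_image]
        simp [map_smul_eq_mul]) with
    mul_le' := fun x y => Real.sSup_le (by
        rintro _ ⟨p, hp, rfl⟩
        exact (p.mul_le x y).trans
          (mul_le_mul (le p hp x) (le p hp y) (p.nonneg y) (nn x)))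
        (mul_nonneg (nn x) (nn y))
    sq_le' := fun x => by
      refine (Real.le_sqrt (nn x) (nn _)).1 (Real.sSup_le ?_ (Real.sqrt_nonneg _))
      rintro _ ⟨p, hp, rfl⟩
      exact Real.le_sqrt_of_sq_le ((p.sq_le x).trans (le p hp _)) }

theorem sup_apply (S : Set (CStarSeminorm P)) (hS) (x : P) :
    sup S hS x = sSup ((fun p : CStarSeminorm P => p x) '' S) := rfl

theorem le_sup {S : Set (CStarSeminorm P)} (hS) {p : CStarSeminorm P} (hp : p ∈ S) (x : P) :
    p x ≤ sup S hS x :=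
  le_csSup (hS x) ⟨p, hp, rfl⟩

theorem sup_le {S : Set (CStarSeminorm P)} (hS) {x : P} {C : ℝ} (hC : 0 ≤ C)
    (h : ∀ p ∈ S, p x ≤ C) : sup S hS x ≤ C :=
  Real.sSup_le (by rintro _ ⟨p, hp, rfl⟩; exact h p hp) hC

end Basic

section Completion

variable {P : Type u} [Ring P] [StarRing P] [Algebra ℂ P]

/-- The *-algebra `P` regarded as a seminormed algebra via the C*-seminorm `p`. -/
def Pre (_p : CStarSeminorm P) : Type u := P

instance (p : CStarSeminorm P) : Ring p.Pre := inferInstanceAs (Ring P)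
instance (p : CStarSeminorm P) : StarRing p.Pre := inferInstanceAs (StarRing P)
instance (p : CStarSeminorm P) : Algebra ℂ p.Pre := inferInstanceAs (Algebra ℂ P)
instance [StarModule ℂ P] (p : CStarSeminorm P) : StarModule ℂ p.Pre := inferInstanceAs (StarModule ℂ P)

noncomputable instance (p : CStarSeminorm P) : SeminormedRing p.Pre :=
  { (inferInstance : Ring p.Pre),
    AddGroupSeminorm.toSeminormedAddCommGroup (E := p.Pre) p.toAddGroupSeminorm with
    norm_mul_le := p.mul_le }

theorem Pre.norm_def (p : CStarSeminorm P) (x : p.Pre) : ‖x‖ = p x := rfl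

noncomputable instance (p : CStarSeminorm P) : NormedAlgebra ℂ p.Pre where
  norm_smul_le a x := (map_smul_eq_mul p a x).le

instance (p : CStarSeminorm P) : NormedStarGroup p.Pre where
  norm_star_le x := (p.map_star x).le

/-- The C*-algebra obtained from the *-algebra `P` by dividing out the null space of the
C*-seminorm `p` and completing. -/
def Compl (p : CStarSeminorm P) : Type u := UniformSpace.Completion p.Pre

open UniformSpace in
noncomputable instance (p : CStarSeminorm P) : NormedRing p.Compl :=
  inferInstanceAs (NormedRing (Completion p.Pre))

open UniformSpace in
noncomputable instance (p : CStarSeminorm P) : NormedAlgebra ℂ p.Compl :=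
  { (inferInstanceAs (Algebra ℂ (Completion p.Pre)) : Algebra ℂ p.Compl) with
    norm_smul_le := fun a x => norm_smul_le (β := Completion p.Pre) a x }

instance (p : CStarSeminorm P) : CompleteSpace p.Compl :=
  inferInstanceAs (CompleteSpace (UniformSpace.Completion p.Pre))

/-- The canonical map from `P` to its completion, as a function. -/
noncomputable def toCompl (p : CStarSeminorm P) (x : P) : p.Compl :=
  ((show p.Pre from x : p.Pre) : UniformSpace.Completion p.Pre)

variable (p : CStarSeminorm P)

theorem norm_toCompl (x : P) : ‖p.toCompl x‖ = p x :=
  UniformSpace.Completion.norm_coe (E := p.Pre) x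

theorem denseRange_toCompl : DenseRange p.toCompl :=
  UniformSpace.Completion.denseRange_coe (α := p.Pre)

theorem toCompl_add (x y : P) : p.toCompl (x + y) = p.toCompl x + p.toCompl y :=
  UniformSpace.Completion.coe_add (α := p.Pre) x y

theorem toCompl_mul (x y : P) : p.toCompl (x * y) = p.toCompl x * p.toCompl y :=
  UniformSpace.Completion.coe_mul (α := p.Pre) x y

theorem toCompl_one : p.toCompl 1 = 1 := UniformSpace.Completion.coe_one p.Pre

theorem toCompl_zero : p.toCompl 0 = 0 := UniformSpace.Completion.coe_zero (α := p.Pre)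

theorem toCompl_smul (a : ℂ) (x : P) : p.toCompl (a • x) = a • p.toCompl x :=
  UniformSpace.Completion.coe_smul (X := p.Pre) a x

/-- Prove a closed condition on the completion by checking it on the image of `P`. -/
theorem compl_induction {C : p.Compl → Prop} (x : p.Compl) (hc : IsClosed {x | C x})
    (h : ∀ x, C (p.toCompl x)) : C x :=
  p.denseRange_toCompl.induction_on x hc h

noncomputable instance : Star p.Compl where
  star := UniformSpace.Completion.map (star : p.Pre → p.Pre)

theorem continuous_star_compl : Continuous (star : p.Compl → p.Compl) :=
  UniformSpace.Completion.continuous_map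

theorem toCompl_star (x : P) : p.toCompl (star x) = star (p.toCompl x) :=
  (UniformSpace.Completion.map_coe
    (NormedStarGroup.to_continuousStar (E := p.Pre) |> fun _ => star_isometry.uniformContinuous)
    (show p.Pre from x)).symm

noncomputable instance : StarRing p.Compl where
  star_involutive x := by
    have hs := p.continuous_star_compl
    refine p.compl_induction (C := fun x => star (star x) = x) x
      (isClosed_eq (hs.comp hs) continuous_id) fun x => ?_
    rw [← toCompl_star, ← toCompl_star, star_star]
  star_mul x y := by
    have hs := p.continuous_star_compl
    refine p.compl_induction (C := fun x => star (x * y) = star y * star x) x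
      (isClosed_eq (hs.comp (by fun_prop)) (by fun_prop)) fun x => ?_
    refine p.compl_induction (C := fun y => star (p.toCompl x * y) = star y * star (p.toCompl x)) y
      (isClosed_eq (hs.comp (by fun_prop)) (by fun_prop)) fun y => ?_
    simp only [← toCompl_star, ← toCompl_mul, star_mul]
  star_add x y := by
    have hs := p.continuous_star_compl
    refine p.compl_induction (C := fun x => star (x + y) = star x + star y) x
      (isClosed_eq (hs.comp (by fun_prop)) (by fun_prop)) fun x => ?_
    refine p.compl_induction (C := fun y => star (p.toCompl x + y) = star (p.toCompl x) + star y) y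
      (isClosed_eq (hs.comp (by fun_prop)) (by fun_prop)) fun y => ?_
    simp only [← toCompl_star, ← toCompl_add, star_add]

instance : CStarRing p.Compl where
  norm_mul_self_le x := by
    have hs := p.continuous_star_compl
    refine p.compl_induction (C := fun x => ‖x‖ * ‖x‖ ≤ ‖star x * x‖) x
      (isClosed_le (continuous_norm.mul continuous_norm)
        (continuous_norm.comp (hs.mul continuous_id))) fun x => ?_
    rw [← toCompl_star, ← toCompl_mul, norm_toCompl, norm_toCompl, ← sq]
    exact p.sq_le x

instance [StarModule ℂ P] : StarModule ℂ p.Compl where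
  star_smul a x := by
    have hs := p.continuous_star_compl
    refine p.compl_induction (C := fun x => star (a • x) = star a • star x) x
      (isClosed_eq (hs.comp (continuous_const_smul a)) (hs.const_smul (star a))) fun x => ?_
    rw [← toCompl_smul, ← toCompl_star, ← toCompl_star, ← toCompl_smul, star_smul]

noncomputable instance [StarModule ℂ P] : CStarAlgebra p.Compl where

/-- The canonical *-homomorphism from `P` to its completion. -/
noncomputable def ι : P →⋆ₐ[ℂ] p.Compl where
  toFun := p.toCompl
  map_one' := p.toCompl_one
  map_mul' := p.toCompl_mul
  map_zero' := p.toCompl_zero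
  map_add' := p.toCompl_add
  commutes' a := by
    rw [Algebra.algebraMap_eq_smul_one, toCompl_smul, toCompl_one, Algebra.algebraMap_eq_smul_one]
  map_star' := p.toCompl_star

theorem norm_ι (x : P) : ‖p.ι x‖ = p x := p.norm_toCompl x

theorem denseRange_ι : DenseRange p.ι := p.denseRange_toCompl

variable {p}

theorem hom_continuous {B : Type v} [CStarAlgebra B] (f : P →⋆ₐ[ℂ] B) (hf : ∀ x, ‖f x‖ ≤ p x) :
    Continuous (show p.Pre →+* B from (f : P →+* B)) :=
  AddMonoidHomClass.continuous_of_bound (show p.Pre →+* B from (f : P →+* B)) 1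
    (fun x => by rw [one_mul]; exact hf x)

/-- A *-homomorphism dominated by the C*-seminorm `p` extends to the completion. -/
noncomputable def lift {B : Type v} [CStarAlgebra B] (f : P →⋆ₐ[ℂ] B) (hf : ∀ x, ‖f x‖ ≤ p x) :
    p.Compl →⋆ₐ[ℂ] B :=
  let F : p.Compl →+* B := UniformSpace.Completion.extensionHom
    (show p.Pre →+* B from (f : P →+* B)) (hom_continuous f hf)
  have hF : ∀ x, F (p.ι x) = f x := fun x =>
    UniformSpace.Completion.extensionHom_coe _ (hom_continuous f hf) (show p.Pre from x)
  have hc : Continuous F := UniformSpace.Completion.continuous_extension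
  { F with
    commutes' := fun a => by
      have h := hF (algebraMap ℂ P a)
      rw [AlgHomClass.commutes f] at h
      rw [← h, AlgHomClass.commutes p.ι]
      rfl
    map_star' := fun x => by
      have hs := p.continuous_star_compl
      refine p.compl_induction (C := fun x => F (star x) = star (F x)) x
        (isClosed_eq (hc.comp hs) hc.star) fun x => ?_
      change F (star (p.ι x)) = star (F (p.ι x))
      rw [← StarHomClass.map_star p.ι, hF, hF, StarHomClass.map_star f] }

theorem lift_ι {B : Type v} [CStarAlgebra B] (f : P →⋆ₐ[ℂ] B) (hf : ∀ x, ‖f x‖ ≤ p x) (x : P) :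
    lift f hf (p.ι x) = f x :=
  UniformSpace.Completion.extensionHom_coe _ (hom_continuous f hf) (show p.Pre from x)

end Completion

/-- The C*-seminorm `x ↦ ‖f x‖` defined by a *-homomorphism `f` into a C*-algebra. -/
noncomputable def ofHom {P : Type u} [Ring P] [StarRing P] [Algebra ℂ P]
    {B : Type v} [CStarAlgebra B] (f : P →⋆ₐ[ℂ] B) : CStarSeminorm P :=
  { Seminorm.of (fun x => ‖f x‖) (fun x y => by rw [map_add]; exact norm_add_le _ _)
      (fun a x => by rw [map_smul, norm_smul]) with
    mul_le' := fun x y => by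
      change ‖f (x * y)‖ ≤ ‖f x‖ * ‖f y‖
      rw [map_mul]; exact norm_mul_le _ _
    sq_le' := fun x => by
      change ‖f x‖ ^ 2 ≤ ‖f (star x * x)‖
      rw [map_mul, StarHomClass.map_star, CStarRing.norm_star_mul_self, sq] }

theorem ofHom_apply {P : Type u} [Ring P] [StarRing P] [Algebra ℂ P]
    {B : Type v} [CStarAlgebra B] (f : P →⋆ₐ[ℂ] B) (x : P) : ofHom f x = ‖f x‖ := rfl

end CStarSeminorm

/-! ### The minimal (spatial) tensor product of C*-algebras -/

section MinTensor

/-- The representation `a ⊗ b ↦ π a ⊗ ρ b` of the algebraic tensor product on the tensor product of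
the Hilbert spaces `H` and `K`. -/
noncomputable def tensorRep {A B : Type u} [CStarAlgebra A] [CStarAlgebra B] {H K : Type u}
    [NormedAddCommGroup H] [InnerProductSpace ℂ H] [CompleteSpace H]
    [NormedAddCommGroup K] [InnerProductSpace ℂ K] [CompleteSpace K]
    (π : A →⋆ₐ[ℂ] (H →L[ℂ] H)) (ρ : B →⋆ₐ[ℂ] (K →L[ℂ] K)) :
    A ⊗[ℂ] B →ₐ[ℂ] ((H ⊗[ℂ] K) →L[ℂ] (H ⊗[ℂ] K)) :=
  Algebra.TensorProduct.algHomOfLinearMapTensorProduct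
    (TensorProduct.lift (LinearMap.mk₂ ℂ (fun a b => TensorProduct.mapL (π a) (ρ b))
      (fun a a' b => by rw [map_add, TensorProduct.mapL_add_left])
      (fun c a b => by rw [map_smul, TensorProduct.mapL_smul_left])
      (fun a b b' => by rw [map_add, TensorProduct.mapL_add_right])
      (fun c a b => by rw [map_smul, TensorProduct.mapL_smul_right])))
    (fun a a' b b' => by simp [TensorProduct.mapL_mul])
    (by simp [ContinuousLinearMap.one_def])

section

variable {A B : Type u} [CStarAlgebra A] [CStarAlgebra B] {H K : Type u}
    [NormedAddCommGroup H] [InnerProductSpace ℂ H] [CompleteSpace H]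
    [NormedAddCommGroup K] [InnerProductSpace ℂ K] [CompleteSpace K]
    (π : A →⋆ₐ[ℂ] (H →L[ℂ] H)) (ρ : B →⋆ₐ[ℂ] (K →L[ℂ] K))

theorem tensorRep_tmul (a : A) (b : B) :
    tensorRep π ρ (a ⊗ₜ b) = TensorProduct.mapL (π a) (ρ b) := by
  rfl

theorem inner_tensorRep (x : A ⊗[ℂ] B) (ξ η : H ⊗[ℂ] K) :
    inner ℂ (tensorRep π ρ x ξ) η = inner ℂ ξ (tensorRep π ρ (star x) η) := by
  induction x using TensorProduct.induction_on generalizing ξ η with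
  | zero => simp
  | add x y hx hy =>
    simp [map_add, inner_add_left, inner_add_right, hx, hy]
  | tmul a b =>
    induction ξ using TensorProduct.induction_on generalizing η with
    | zero => simp
    | add ξ ζ hξ hζ => simp [map_add, inner_add_left, hξ, hζ]
    | tmul h k =>
      induction η using TensorProduct.induction_on with
      | zero => simp
      | add ξ ζ hξ hζ => simp only [map_add, inner_add_right, hξ, hζ]
      | tmul h' k' =>
        rw [TensorProduct.star_tmul, tensorRep_tmul, tensorRep_tmul, StarHomClass.map_star,
          StarHomClass.map_star, TensorProduct.mapL_tmul, TensorProduct.mapL_tmul,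
          TensorProduct.inner_tmul, TensorProduct.inner_tmul,
          ContinuousLinearMap.star_eq_adjoint, ContinuousLinearMap.star_eq_adjoint,
          ContinuousLinearMap.adjoint_inner_right, ContinuousLinearMap.adjoint_inner_right]

/-- The C*-seminorm `x ↦ ‖(π ⊗ ρ) x‖` on the algebraic tensor product. -/
noncomputable def spatialSeminorm : CStarSeminorm (A ⊗[ℂ] B) :=
  { Seminorm.of (fun x => ‖tensorRep π ρ x‖)
      (fun x y => by
        rw [map_add]; exact ContinuousLinearMap.opNorm_add_le _ _)
      (fun a x => by
        rw [map_smul]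
        refine le_antisymm (ContinuousLinearMap.opNorm_smul_le _ _) ?_
        rcases eq_or_ne a 0 with rfl | ha
        · rw [norm_zero, zero_mul]; exact ContinuousLinearMap.opNorm_nonneg _
        · have h := ContinuousLinearMap.opNorm_smul_le a⁻¹ (a • tensorRep π ρ x)
          rw [smul_smul, inv_mul_cancel₀ ha, one_smul, norm_inv] at h
          rwa [← le_inv_mul_iff₀ (norm_pos_iff.2 ha)]) with
    mul_le' := fun x y => by
      change ‖tensorRep π ρ (x * y)‖ ≤ ‖tensorRep π ρ x‖ * ‖tensorRep π ρ y‖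
      rw [map_mul]; exact ContinuousLinearMap.opNorm_comp_le _ _
    sq_le' := fun x => by
      change ‖tensorRep π ρ x‖ ^ 2 ≤ ‖tensorRep π ρ (star x * x)‖
      refine (Real.le_sqrt (ContinuousLinearMap.opNorm_nonneg _)
        (ContinuousLinearMap.opNorm_nonneg _)).1 ?_
      refine ContinuousLinearMap.opNorm_le_bound _ (Real.sqrt_nonneg _) fun ξ => ?_
      rw [← Real.sqrt_sq (norm_nonneg ξ), ← Real.sqrt_mul (ContinuousLinearMap.opNorm_nonneg _)]
      refine Real.le_sqrt_of_sq_le ?_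
      have h1 : inner ℂ (tensorRep π ρ x ξ) (tensorRep π ρ x ξ) =
          inner ℂ ξ (tensorRep π ρ (star x * x) ξ) := by
        rw [inner_tensorRep, map_mul]; rfl
      calc ‖tensorRep π ρ x ξ‖ ^ 2
          = ‖(inner ℂ (tensorRep π ρ x ξ) (tensorRep π ρ x ξ) : ℂ)‖ := by
            have h2 : (inner ℂ (tensorRep π ρ x ξ) (tensorRep π ρ x ξ) : ℂ) =
                (‖tensorRep π ρ x ξ‖ : ℂ) ^ 2 :=
              inner_self_eq_norm_sq_to_K (𝕜 := ℂ) (tensorRep π ρ x ξ)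
            rw [h2, norm_pow, Complex.norm_real, norm_norm]
        _ = ‖(inner ℂ ξ (tensorRep π ρ (star x * x) ξ) : ℂ)‖ := by rw [h1]
        _ ≤ ‖ξ‖ * ‖tensorRep π ρ (star x * x) ξ‖ :=
            norm_inner_le_norm (𝕜 := ℂ) (E := H ⊗[ℂ] K) _ _
        _ ≤ ‖ξ‖ * (‖tensorRep π ρ (star x * x)‖ * ‖ξ‖) := by
            gcongr; exact ContinuousLinearMap.le_opNorm _ _
        _ = _ := by ring }

theorem spatialSeminorm_apply (x : A ⊗[ℂ] B) : spatialSeminorm π ρ x = ‖tensorRep π ρ x‖ := rfl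

end

/-- All C*-seminorms on `A ⊗ B` that come from a pair of representations of `A` and `B`. -/
def spatialSeminorms (A B : Type u) [CStarAlgebra A] [CStarAlgebra B] :
    Set (CStarSeminorm (A ⊗[ℂ] B)) :=
  {p | ∃ (H K : Type u) (_ : NormedAddCommGroup H) (_ : InnerProductSpace ℂ H)
      (_ : CompleteSpace H) (_ : NormedAddCommGroup K) (_ : InnerProductSpace ℂ K)
      (_ : CompleteSpace K) (π : A →⋆ₐ[ℂ] (H →L[ℂ] H)) (ρ : B →⋆ₐ[ℂ] (K →L[ℂ] K)),
      p = spatialSeminorm π ρ}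

theorem bddAbove_spatialSeminorms (A B : Type u) [CStarAlgebra A] [CStarAlgebra B]
    (x : A ⊗[ℂ] B) :
    BddAbove ((fun p : CStarSeminorm (A ⊗[ℂ] B) => p x) '' spatialSeminorms A B) := by
  suffices h : ∃ C, ∀ p ∈ spatialSeminorms A B, p x ≤ C by
    obtain ⟨C, hC⟩ := h
    exact ⟨C, by rintro _ ⟨p, hp, rfl⟩; exact hC p hp⟩
  induction x using TensorProduct.induction_on with
  | zero => exact ⟨0, fun p _ => (map_zero p).le⟩
  | add x y hx hy =>
    obtain ⟨C, hC⟩ := hx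
    obtain ⟨D, hD⟩ := hy
    exact ⟨C + D, fun p hp => (map_add_le_add p x y).trans (add_le_add (hC p hp) (hD p hp))⟩
  | tmul a b =>
    refine ⟨‖a‖ * ‖b‖, ?_⟩
    rintro _ ⟨H, K, _, _, _, _, _, _, π, ρ, rfl⟩
    rw [spatialSeminorm_apply, tensorRep_tmul]
    refine (TensorProduct.norm_mapL_le _ _).trans ?_
    exact mul_le_mul (NonUnitalStarAlgHom.norm_apply_le π a) (NonUnitalStarAlgHom.norm_apply_le ρ b)
      (norm_nonneg _) (norm_nonneg _)

/-- The minimal (spatial) C*-norm on the algebraic tensor product: the supremum of `‖(π ⊗ ρ) x‖`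
over all pairs of representations `π` of `A` and `ρ` of `B` on Hilbert spaces. -/
noncomputable def minNorm (A B : Type u) [CStarAlgebra A] [CStarAlgebra B] :
    CStarSeminorm (A ⊗[ℂ] B) :=
  CStarSeminorm.sup (spatialSeminorms A B) (bddAbove_spatialSeminorms A B)

/-- The minimal C*-tensor product of two C*-algebras. -/
abbrev MinTensor (A B : Type u) [CStarAlgebra A] [CStarAlgebra B] : Type u := (minNorm A B).Compl

namespace MinTensor

variable {A B C D : Type u} [CStarAlgebra A] [CStarAlgebra B] [CStarAlgebra C] [CStarAlgebra D]

/-- The elementary tensor `a ⊗ b` in the minimal tensor product. -/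
noncomputable def tmul (a : A) (b : B) : MinTensor A B := (minNorm A B).ι (a ⊗ₜ b)

/-- The algebraic tensor product of two *-homomorphisms. -/
noncomputable def algMap (φ : A →⋆ₐ[ℂ] C) (ψ : B →⋆ₐ[ℂ] D) : A ⊗[ℂ] B →⋆ₐ[ℂ] C ⊗[ℂ] D :=
  { Algebra.TensorProduct.map (φ : A →ₐ[ℂ] C) (ψ : B →ₐ[ℂ] D) with
    map_star' := fun x => by
      change Algebra.TensorProduct.map (φ : A →ₐ[ℂ] C) (ψ : B →ₐ[ℂ] D) (star x) =
        star (Algebra.TensorProduct.map (φ : A →ₐ[ℂ] C) (ψ : B →ₐ[ℂ] D) x)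
      induction x using TensorProduct.induction_on with
      | zero => simp
      | add x y hx hy => simp only [star_add, map_add, hx, hy]
      | tmul a b => simp [StarHomClass.map_star] }

theorem algMap_tmul (φ : A →⋆ₐ[ℂ] C) (ψ : B →⋆ₐ[ℂ] D) (a : A) (b : B) :
    algMap φ ψ (a ⊗ₜ b) = φ a ⊗ₜ ψ b := rfl

theorem minNorm_algMap_le (φ : A →⋆ₐ[ℂ] C) (ψ : B →⋆ₐ[ℂ] D) (x : A ⊗[ℂ] B) :
    minNorm C D (algMap φ ψ x) ≤ minNorm A B x := by
  refine CStarSeminorm.sup_le _ ((minNorm A B).nonneg x) ?_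
  rintro _ ⟨H, K, _, _, _, _, _, _, π, ρ, rfl⟩
  have h : tensorRep π ρ (algMap φ ψ x) = tensorRep (π.comp φ) (ρ.comp ψ) x := by
    induction x using TensorProduct.induction_on with
    | zero => simp
    | add x y hx hy => simp only [map_add, hx, hy]
    | tmul a b => simp [algMap_tmul, tensorRep_tmul]
  rw [spatialSeminorm_apply, h, ← spatialSeminorm_apply]
  exact CStarSeminorm.le_sup (S := spatialSeminorms A B) _
    ⟨H, K, _, _, _, _, _, _, π.comp φ, ρ.comp ψ, rfl⟩ x

/-- The *-homomorphism `φ ⊗ ψ` between minimal tensor products. -/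
noncomputable def map (φ : A →⋆ₐ[ℂ] C) (ψ : B →⋆ₐ[ℂ] D) : MinTensor A B →⋆ₐ[ℂ] MinTensor C D :=
  CStarSeminorm.lift ((minNorm C D).ι.comp (algMap φ ψ)) (fun x => by
    rw [StarAlgHom.comp_apply, CStarSeminorm.norm_ι]
    exact minNorm_algMap_le φ ψ x)

theorem map_tmul (φ : A →⋆ₐ[ℂ] C) (ψ : B →⋆ₐ[ℂ] D) (a : A) (b : B) :
    map φ ψ (tmul a b) = tmul (φ a) (ψ b) :=
  CStarSeminorm.lift_ι _ _ _

end MinTensor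

end MinTensor

/-! ### Universal C*-algebras given by generators and relations -/

/-- The free unital *-algebra over `ℂ` on a set `X` of generators: noncommutative polynomials in
the letters `Sum.inl x` (the generator `x`) and `Sum.inr x` (its adjoint). -/
def FreeStarAlgebra (X : Type u) : Type u := MonoidAlgebra ℂ (FreeMonoid (X ⊕ X))

namespace FreeStarAlgebra

variable {X : Type u}

noncomputable instance : Ring (FreeStarAlgebra X) :=
  inferInstanceAs (Ring (MonoidAlgebra ℂ (FreeMonoid (X ⊕ X))))

noncomputable instance : Algebra ℂ (FreeStarAlgebra X) :=
  inferInstanceAs (Algebra ℂ (MonoidAlgebra ℂ (FreeMonoid (X ⊕ X))))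

/-- The adjoint of a word: reverse it and replace each letter by its adjoint. -/
def starWord (w : FreeMonoid (X ⊕ X)) : FreeMonoid (X ⊕ X) :=
  FreeMonoid.reverse (FreeMonoid.map Sum.swap w)

theorem starWord_mul (w w' : FreeMonoid (X ⊕ X)) :
    starWord (w * w') = starWord w' * starWord w := by
  simp [starWord, FreeMonoid.reverse_mul]

theorem starWord_starWord (w : FreeMonoid (X ⊕ X)) : starWord (starWord w) = w := by
  induction w using FreeMonoid.inductionOn with
  | one => rfl
  | of x => cases x <;> rfl
  | mul w w' h h' => rw [starWord_mul, starWord_mul, h, h']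

/-- The element `a • w` of the free *-algebra. -/
noncomputable def mono (w : FreeMonoid (X ⊕ X)) (a : ℂ) : FreeStarAlgebra X :=
  MonoidAlgebra.single w a

theorem mono_mul (w w' : FreeMonoid (X ⊕ X)) (a b : ℂ) :
    mono w a * mono w' b = mono (w * w') (a * b) :=
  MonoidAlgebra.single_mul_single ..

theorem mono_smul (w : FreeMonoid (X ⊕ X)) (a b : ℂ) : a • mono w b = mono w (a * b) :=
  MonoidAlgebra.smul_single ..

theorem mono_induction {C : FreeStarAlgebra X → Prop} (x : FreeStarAlgebra X) (h0 : C 0)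
    (hadd : ∀ x y, C x → C y → C (x + y)) (h : ∀ w a, C (mono w a)) : C x :=
  MonoidAlgebra.induction_linear (motive := C) x h0 hadd h

/-- The conjugate-linear involution, as an additive map. -/
noncomputable def starHom : FreeStarAlgebra X →+ FreeStarAlgebra X :=
  (Finsupp.liftAddHom (fun w => (MonoidAlgebra.singleAddHom (starWord w)).comp
    (starAddEquiv : ℂ ≃+ ℂ).toAddMonoidHom)).comp
    (MonoidAlgebra.coeffAddEquiv (R := ℂ) (M := FreeMonoid (X ⊕ X))).toAddMonoidHom

theorem starHom_mono (w : FreeMonoid (X ⊕ X)) (a : ℂ) :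
    starHom (mono w a) = mono (starWord w) (star a) := by
  exact Finsupp.liftAddHom_apply_single _ w a

noncomputable instance : StarRing (FreeStarAlgebra X) where
  star := starHom
  star_involutive x := by
    induction x using mono_induction with
    | h0 => simp
    | hadd x y hx hy => rw [map_add, map_add, hx, hy]
    | h w a => rw [starHom_mono, starHom_mono, starWord_starWord, star_star]
  star_mul x y := by
    change starHom (x * y) = starHom y * starHom x
    induction x using mono_induction with
    | h0 => simp
    | hadd x x' hx hx' => rw [add_mul, map_add, map_add, hx, hx', mul_add]
    | h w a =>
      induction y using mono_induction with
      | h0 => simp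
      | hadd x x' hx hx' => rw [mul_add, map_add, map_add, hx, hx', add_mul]
      | h w' b =>
        rw [mono_mul, starHom_mono, starHom_mono, starHom_mono, mono_mul, starWord_mul, star_mul]
  star_add x y := map_add starHom x y

theorem star_mono (w : FreeMonoid (X ⊕ X)) (a : ℂ) :
    star (mono w a) = mono (starWord w) (star a) := starHom_mono w a

instance : StarModule ℂ (FreeStarAlgebra X) where
  star_smul a x := by
    induction x using mono_induction with
    | h0 => simp
    | hadd x y hx hy => rw [smul_add, star_add, star_add, hx, hy, smul_add]
    | h w b => rw [mono_smul, star_mono, star_mono, mono_smul, star_mul, mul_comm]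

/-- The generator `x`. -/
noncomputable def gen (x : X) : FreeStarAlgebra X := mono (FreeMonoid.of (Sum.inl x)) 1

/-- Every element of the free *-algebra is built from scalars and generators. -/
theorem gen_induction {C : FreeStarAlgebra X → Prop} (x : FreeStarAlgebra X)
    (h1 : ∀ a, C (algebraMap ℂ _ a)) (hgen : ∀ x, C (gen x)) (hstar : ∀ x, C x → C (star x))
    (hadd : ∀ x y, C x → C y → C (x + y)) (hmul : ∀ x y, C x → C y → C (x * y)) : C x := by
  induction x using mono_induction with
  | h0 => simpa using h1 0
  | hadd x y hx hy => exact hadd x y hx hy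
  | h w a =>
    induction w using FreeMonoid.inductionOn generalizing a with
    | one => exact h1 a
    | mul w w' h h' => simpa [mono_mul] using hmul _ _ (h a) (h' 1)
    | of x =>
      have hs : ∀ x, mono (FreeMonoid.of x) a = algebraMap ℂ (FreeStarAlgebra X) a *
          mono (FreeMonoid.of x) 1 := fun x => by
        rw [← Algebra.smul_def, mono_smul, mul_one]
      rw [hs]
      refine hmul _ _ (h1 a) ?_
      cases x with
      | inl x => exact hgen x
      | inr x =>
        have : star (gen x) = mono (FreeMonoid.of (Sum.inr x)) 1 := by
          rw [gen, star_mono, star_one]; rfl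
        rw [← this]
        exact hstar _ (hgen x)

/-- The *-homomorphism that sends each generator `x` to `v x`. -/
noncomputable def lift {B : Type v} [Ring B] [StarRing B] [Algebra ℂ B] [StarModule ℂ B]
    (v : X → B) : FreeStarAlgebra X →⋆ₐ[ℂ] B :=
  let F : FreeStarAlgebra X →ₐ[ℂ] B := MonoidAlgebra.lift ℂ B (FreeMonoid (X ⊕ X))
    (FreeMonoid.lift (Sum.elim v (star ∘ v)))
  have hF : ∀ w a, F (mono w a) = a • FreeMonoid.lift (Sum.elim v (star ∘ v)) w := fun w a =>
    MonoidAlgebra.lift_single ..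
  { F with
    map_star' := fun x => by
      change F (star x) = star (F x)
      induction x using mono_induction with
      | h0 => simp
      | hadd x y hx hy => rw [star_add, map_add, map_add, hx, hy, star_add]
      | h w a =>
        rw [star_mono, hF, hF, star_smul]
        congr 1
        induction w using FreeMonoid.inductionOn with
        | one =>
          rw [show starWord (1 : FreeMonoid (X ⊕ X)) = 1 from rfl, map_one, star_one]
        | of x => cases x <;> simp [starWord]
        | mul w w' h h' => rw [starWord_mul, map_mul, map_mul, h, h', star_mul] }

theorem lift_gen {B : Type v} [Ring B] [StarRing B] [Algebra ℂ B] [StarModule ℂ B]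
    (v : X → B) (x : X) : lift v (gen x) = v x := by
  refine (MonoidAlgebra.lift_single ..).trans ?_
  simp

end FreeStarAlgebra

section Universal

variable {X : Type u}

/-- The C*-seminorms on the free *-algebra for which all the relations `r = 0`, `r ∈ R`, hold. -/
def relationSeminorms (R : Set (FreeStarAlgebra X)) : Set (CStarSeminorm (FreeStarAlgebra X)) :=
  {p | ∀ r ∈ R, p r = 0}

theorem bddAbove_relationSeminorms (R : Set (FreeStarAlgebra X))
    (hR : ∀ x, ∃ C, ∀ p ∈ relationSeminorms R, p (FreeStarAlgebra.gen x) ≤ C)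
    (x : FreeStarAlgebra X) :
    BddAbove ((fun p : CStarSeminorm (FreeStarAlgebra X) => p x) '' relationSeminorms R) := by
  suffices h : ∃ C, ∀ p ∈ relationSeminorms R, p x ≤ C by
    obtain ⟨C, hC⟩ := h
    exact ⟨C, by rintro _ ⟨p, hp, rfl⟩; exact hC p hp⟩
  induction x using FreeStarAlgebra.gen_induction with
  | h1 a =>
    refine ⟨‖a‖, fun p _ => ?_⟩
    have h1 : p 1 ≤ 1 := by
      have := p.sq_le 1
      rw [star_one, one_mul] at this
      nlinarith [p.nonneg 1]
    rw [Algebra.algebraMap_eq_smul_one, map_smul_eq_mul]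
    exact mul_le_of_le_one_right (norm_nonneg a) h1
  | hgen x => exact hR x
  | hstar x hx =>
    obtain ⟨C, hC⟩ := hx
    exact ⟨C, fun p hp => (p.map_star x).trans_le (hC p hp)⟩
  | hadd x y hx hy =>
    obtain ⟨C, hC⟩ := hx
    obtain ⟨D, hD⟩ := hy
    exact ⟨C + D, fun p hp => (map_add_le_add p x y).trans (add_le_add (hC p hp) (hD p hp))⟩
  | hmul x y hx hy =>
    obtain ⟨C, hC⟩ := hx
    obtain ⟨D, hD⟩ := hy
    exact ⟨C * D, fun p hp => (p.mul_le x y).trans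
      (mul_le_mul (hC p hp) (hD p hp) (p.nonneg y) ((p.nonneg x).trans (hC p hp)))⟩

/-- The largest C*-seminorm on the free *-algebra for which the relations `r = 0`, `r ∈ R`, hold;
it exists as soon as the relations bound every generator. -/
noncomputable def universalNorm (R : Set (FreeStarAlgebra X))
    (hR : ∀ x, ∃ C, ∀ p ∈ relationSeminorms R, p (FreeStarAlgebra.gen x) ≤ C) :
    CStarSeminorm (FreeStarAlgebra X) :=
  CStarSeminorm.sup (relationSeminorms R) (bddAbove_relationSeminorms R hR)

/-- The universal unital C*-algebra with generators `X` and relations `r = 0`, `r ∈ R`. -/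
abbrev UniversalCStarAlgebra (R : Set (FreeStarAlgebra X))
    (hR : ∀ x, ∃ C, ∀ p ∈ relationSeminorms R, p (FreeStarAlgebra.gen x) ≤ C) : Type u :=
  (universalNorm R hR).Compl

namespace UniversalCStarAlgebra

variable {R : Set (FreeStarAlgebra X)}
  (hR : ∀ x, ∃ C, ∀ p ∈ relationSeminorms R, p (FreeStarAlgebra.gen x) ≤ C)

theorem relation {r : FreeStarAlgebra X} (hr : r ∈ R) : (universalNorm R hR).ι r = 0 := by
  rw [← norm_le_zero_iff, CStarSeminorm.norm_ι]
  exact CStarSeminorm.sup_le _ le_rfl (fun p hp => (hp r hr).le)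

/-- The universal property. -/
noncomputable def lift {B : Type v} [CStarAlgebra B] (v : X → B)
    (hv : ∀ r ∈ R, FreeStarAlgebra.lift v r = 0) : UniversalCStarAlgebra R hR →⋆ₐ[ℂ] B :=
  CStarSeminorm.lift (FreeStarAlgebra.lift v) (fun x =>
    CStarSeminorm.le_sup (S := relationSeminorms R) _
      (p := CStarSeminorm.ofHom (FreeStarAlgebra.lift v))
      (fun r hr => by rw [CStarSeminorm.ofHom_apply, hv r hr, norm_zero]) x)

theorem lift_gen {B : Type v} [CStarAlgebra B] (v : X → B)
    (hv : ∀ r ∈ R, FreeStarAlgebra.lift v r = 0) (x : X) :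
    lift hR v hv ((universalNorm R hR).ι (FreeStarAlgebra.gen x)) = v x :=
  (CStarSeminorm.lift_ι _ _ _).trans (FreeStarAlgebra.lift_gen v x)

theorem adjoin_gen_dense :
    (StarAlgebra.adjoin ℂ (Set.range fun x =>
      (universalNorm R hR).ι (FreeStarAlgebra.gen x))).topologicalClosure = ⊤ := by
  refine top_le_iff.1 fun y _ => ?_
  have h : ∀ x : FreeStarAlgebra X, (universalNorm R hR).ι x ∈
      StarAlgebra.adjoin ℂ (Set.range fun x => (universalNorm R hR).ι (FreeStarAlgebra.gen x)) := by
    intro x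
    induction x using FreeStarAlgebra.gen_induction with
    | h1 a => rw [AlgHomClass.commutes]; exact algebraMap_mem _ a
    | hgen x => exact StarAlgebra.subset_adjoin ℂ _ ⟨x, rfl⟩
    | hstar x hx => rw [StarHomClass.map_star]; exact star_mem hx
    | hadd x y hx hy => rw [map_add]; exact add_mem hx hy
    | hmul x y hx hy => rw [map_mul]; exact mul_mem hx hy
  exact CStarSeminorm.compl_induction _ y (StarSubalgebra.isClosed_topologicalClosure _)
    (fun x => subset_closure (h x))

end UniversalCStarAlgebra

end Universal

/-! ### Quantum automorphism groups of graphs -/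

section Qut

/-- The defining relations of the quantum automorphism group of the graph `X` with vertex coloring
`c`, for a matrix `u` over a *-algebra: `u` is a magic unitary, it respects the edges of `X`, and it
respects the colors. -/
structure IsQuantumAut {V : Type u} [Fintype V] {K : Type v} (X : SimpleGraph V) (c : V → K)
    {A : Type*} [Ring A] [StarRing A] (w : V → V → A) : Prop where
  selfAdjoint : ∀ i j, star (w i j) = w i j
  idempotent : ∀ i j, w i j * w i j = w i j
  row_sum : ∀ i, ∑ k, w i k = 1
  col_sum : ∀ j, ∑ k, w k j = 1
  edge : ∀ i j k l, (X.Adj i k ∧ ¬ X.Adj j l ∨ ¬ X.Adj i k ∧ X.Adj j l) → w i j * w k l = 0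
  color : ∀ i j, c i ≠ c j → w i j = 0

variable {V : Type u} [Fintype V] {K : Type v} (X : SimpleGraph V) (c : V → K)

/-- The elements of the free *-algebra on the generators `u i j` that are set to zero in the
function algebra of the quantum automorphism group. -/
inductive QutRelation : FreeStarAlgebra (V × V) → Prop
  | selfAdjoint (i j : V) : QutRelation
      (star (FreeStarAlgebra.gen (i, j)) - FreeStarAlgebra.gen (i, j))
  | idempotent (i j : V) : QutRelation
      (FreeStarAlgebra.gen (i, j) * FreeStarAlgebra.gen (i, j) - FreeStarAlgebra.gen (i, j))
  | row_sum (i : V) : QutRelation (∑ k, FreeStarAlgebra.gen (i, k) - 1)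
  | col_sum (j : V) : QutRelation (∑ k, FreeStarAlgebra.gen (k, j) - 1)
  | edge (i j k l : V) (h : X.Adj i k ∧ ¬ X.Adj j l ∨ ¬ X.Adj i k ∧ X.Adj j l) : QutRelation
      (FreeStarAlgebra.gen (i, j) * FreeStarAlgebra.gen (k, l))
  | color (i j : V) (h : c i ≠ c j) : QutRelation (FreeStarAlgebra.gen (i, j))

theorem qutRelation_bounded (x : V × V) :
    ∃ C, ∀ p ∈ relationSeminorms {r | QutRelation X c r}, p (FreeStarAlgebra.gen x) ≤ C := by
  refine ⟨1, fun p hp => ?_⟩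
  obtain ⟨i, j⟩ := x
  set g : FreeStarAlgebra (V × V) := FreeStarAlgebra.gen (i, j) with hg
  have h1 : p (star g - g) = 0 := hp _ (.selfAdjoint i j)
  have h2 : p (g * g - g) = 0 := hp _ (.idempotent i j)
  have h3 : p (star g * g) ≤ p g := by
    have e : star g * g = (star g - g) * g + (g * g - g) + g := by noncomm_ring
    calc p (star g * g) ≤ p ((star g - g) * g) + p (g * g - g) + p g := by
          rw [e]
          exact (map_add_le_add p _ _).trans (add_le_add_left (map_add_le_add p _ _) _)
      _ ≤ p (star g - g) * p g + p (g * g - g) + p g := by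
          gcongr; exact p.mul_le _ _
      _ = p g := by rw [h1, h2]; ring
  nlinarith [p.sq_le g, p.nonneg g]

/-- The C*-algebra `C(Qut_c(X))`. -/
abbrev QutAlgebra : Type u :=
  UniversalCStarAlgebra {r | QutRelation X c r} (qutRelation_bounded X c)

namespace QutAlgebra

/-- The generators `u i j` of `C(Qut_c(X))`. -/
noncomputable def u (i j : V) : QutAlgebra X c :=
  (universalNorm {r | QutRelation X c r} (qutRelation_bounded X c)).ι (FreeStarAlgebra.gen (i, j))

theorem isQuantumAut_u : IsQuantumAut X c (u X c) where
  selfAdjoint i j := by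
    have := UniversalCStarAlgebra.relation (qutRelation_bounded X c) (.selfAdjoint i j)
    rwa [map_sub, StarHomClass.map_star, sub_eq_zero] at this
  idempotent i j := by
    have := UniversalCStarAlgebra.relation (qutRelation_bounded X c) (.idempotent i j)
    rwa [map_sub, map_mul, sub_eq_zero] at this
  row_sum i := by
    have := UniversalCStarAlgebra.relation (qutRelation_bounded X c) (.row_sum i)
    rwa [map_sub, map_sum, map_one, sub_eq_zero] at this
  col_sum j := by
    have := UniversalCStarAlgebra.relation (qutRelation_bounded X c) (.col_sum j)
    rwa [map_sub, map_sum, map_one, sub_eq_zero] at this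
  edge i j k l h := by
    have := UniversalCStarAlgebra.relation (qutRelation_bounded X c) (.edge i j k l h)
    rwa [map_mul] at this
  color i j h := UniversalCStarAlgebra.relation (qutRelation_bounded X c) (.color i j h)

variable {X c} in
theorem lift_relation {B : Type*} [CStarAlgebra B] {w : V → V → B} (hw : IsQuantumAut X c w)
    (r : FreeStarAlgebra (V × V)) (hr : r ∈ {r | QutRelation X c r}) :
    FreeStarAlgebra.lift (fun x : V × V => w x.1 x.2) r = 0 := by
  cases hr with
  | selfAdjoint i j =>
    simp [StarHomClass.map_star, FreeStarAlgebra.lift_gen, hw.selfAdjoint i j]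
  | idempotent i j => simp [FreeStarAlgebra.lift_gen, hw.idempotent i j]
  | row_sum i => simp [FreeStarAlgebra.lift_gen, hw.row_sum i]
  | col_sum j => simp [FreeStarAlgebra.lift_gen, hw.col_sum j]
  | edge i j k l h => simp [FreeStarAlgebra.lift_gen, hw.edge i j k l h]
  | color i j h => simp [FreeStarAlgebra.lift_gen, hw.color i j h]

variable {X c} in
/-- The universal property of `C(Qut_c(X))`. -/
noncomputable def lift {B : Type*} [CStarAlgebra B] {w : V → V → B} (hw : IsQuantumAut X c w) :
    QutAlgebra X c →⋆ₐ[ℂ] B :=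
  UniversalCStarAlgebra.lift (qutRelation_bounded X c) (fun x : V × V => w x.1 x.2)
    (lift_relation hw)

variable {X c} in
theorem lift_u {B : Type*} [CStarAlgebra B] {w : V → V → B} (hw : IsQuantumAut X c w) (i j : V) :
    lift hw (u X c i j) = w i j :=
  UniversalCStarAlgebra.lift_gen _ _ _ _

theorem adjoin_u_dense :
    (StarAlgebra.adjoin ℂ {a | ∃ i j, a = u X c i j}).topologicalClosure = ⊤ := by
  rw [← UniversalCStarAlgebra.adjoin_gen_dense (qutRelation_bounded X c)]
  congr 2
  ext a
  constructor
  · rintro ⟨i, j, rfl⟩; exact ⟨(i, j), rfl⟩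
  · rintro ⟨⟨i, j⟩, rfl⟩; exact ⟨i, j, rfl⟩

end QutAlgebra

open scoped ComplexOrder in
/-- Projections in a C*-algebra that sum to `1` are mutually orthogonal. -/
theorem projections_orthogonal {A : Type*} [CStarAlgebra A] {ι : Type*} [Fintype ι] {q : ι → A}
    (hs : ∀ i, star (q i) = q i) (hi : ∀ i, q i * q i = q i) (h1 : ∑ i, q i = 1) {i j : ι}
    (hij : i ≠ j) : q i * q j = 0 := by
  classical
  let _ : PartialOrder A := CStarAlgebra.spectralOrder A
  let _ : StarOrderedRing A := CStarAlgebra.spectralOrderedRing A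
  have h2 : ∑ k ∈ Finset.univ.erase j, star (q k * q j) * (q k * q j) = 0 := by
    have h3 : ∀ k, star (q k * q j) * (q k * q j) = q j * q k * q j := fun k => by
      rw [star_mul, hs, hs, mul_assoc, ← mul_assoc (q k), hi, mul_assoc]
    have h4 : ∑ k, q j * q k * q j = q j := by
      rw [← Finset.sum_mul, ← Finset.mul_sum, h1, mul_one, hi]
    rw [← Finset.add_sum_erase _ _ (Finset.mem_univ j), hi, hi] at h4
    simp only [h3]
    exact left_eq_add.1 h4.symm
  have h5 := (Finset.sum_eq_zero_iff_of_nonneg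
    (fun k _ => star_mul_self_nonneg (q k * q j))).1 h2 i (by simp [hij])
  exact CStarRing.star_mul_self_eq_zero_iff _ |>.1 h5

variable {X c} in
/-- The matrix `∑ k, w i k ⊗ w k j` again satisfies the relations. -/
theorem IsQuantumAut.tensor {A : Type u} [CStarAlgebra A] {w : V → V → A}
    (hw : IsQuantumAut X c w) :
    IsQuantumAut X c (fun i j => ∑ k, MinTensor.tmul (w i k) (w k j)) := by
  have hmul : ∀ i j k l, (∑ m, MinTensor.tmul (w i m) (w m j)) *
      (∑ n, MinTensor.tmul (w k n) (w n l)) =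
      ∑ m, ∑ n, MinTensor.tmul (w i m * w k n) (w m j * w n l) := fun i j k l => by
    simp only [MinTensor.tmul, Finset.sum_mul_sum, ← map_mul, Algebra.TensorProduct.tmul_mul_tmul]
  have hz : ∀ a : A, MinTensor.tmul (0 : A) a = 0 := fun a => by simp [MinTensor.tmul]
  have hz' : ∀ a : A, MinTensor.tmul a (0 : A) = 0 := fun a => by simp [MinTensor.tmul]
  refine ⟨fun i j => ?_, fun i j => ?_, fun i => ?_, fun j => ?_, fun i j k l h => ?_,
    fun i j h => ?_⟩
  · simp only [MinTensor.tmul, star_sum, ← StarHomClass.map_star, TensorProduct.star_tmul,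
      hw.selfAdjoint]
  · rw [hmul]
    refine Finset.sum_congr rfl fun m _ => ?_
    rw [Finset.sum_eq_single m, hw.idempotent, hw.idempotent]
    · intro n _ hn
      rw [projections_orthogonal (hw.selfAdjoint i) (hw.idempotent i) (hw.row_sum i) hn.symm, hz]
    · simp
  · rw [Finset.sum_comm]
    simp only [MinTensor.tmul, ← map_sum, ← TensorProduct.tmul_sum, ← TensorProduct.sum_tmul,
      hw.row_sum]
    exact map_one (minNorm A A).ι
  · rw [Finset.sum_comm]
    simp only [MinTensor.tmul, ← map_sum, ← TensorProduct.sum_tmul, hw.col_sum,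
      ← TensorProduct.tmul_sum]
    exact map_one (minNorm A A).ι
  · rw [hmul]
    refine Finset.sum_eq_zero fun m _ => Finset.sum_eq_zero fun n _ => ?_
    by_cases hmn : X.Adj m n
    · rcases h with h | h
      · rw [hw.edge m j n l (Or.inl ⟨hmn, h.2⟩), hz']
      · rw [hw.edge i m k n (Or.inr ⟨h.1, hmn⟩), hz]
    · rcases h with h | h
      · rw [hw.edge i m k n (Or.inl ⟨h.1, hmn⟩), hz]
      · rw [hw.edge m j n l (Or.inr ⟨hmn, h.2⟩), hz']
  · refine Finset.sum_eq_zero fun m _ => ?_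
    by_cases hm : c i = c m
    · rw [hw.color m j (fun h' => h (hm.trans h')), hz']
    · rw [hw.color i m hm, hz]

end Qut

/-- A compact matrix quantum group: a unital C*-algebra generated by the entries of an invertible
matrix `u` whose entrywise adjoint is invertible too, with a comultiplication `Δ` that satisfies
`Δ (u i j) = ∑ k, u i k ⊗ u k j`. -/
structure CompactMatrixQuantumGroup where
  /-- The function algebra of the quantum group. -/
  Alg : Type u
  [cstar : CStarAlgebra Alg]
  /-- The index set of the fundamental representation. -/
  Index : Type u
  [fintype : Fintype Index]
  [decEq : DecidableEq Index]
  /-- The fundamental representation. -/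
  u : Matrix Index Index Alg
  dense : (StarAlgebra.adjoin ℂ {a | ∃ i j, a = u i j}).topologicalClosure = ⊤
  isUnit_u : IsUnit u
  isUnit_u_star : IsUnit (u.map star)
  /-- The comultiplication. -/
  Δ : Alg →⋆ₐ[ℂ] MinTensor Alg Alg
  Δ_u : ∀ i j, Δ (u i j) = ∑ k, MinTensor.tmul (u i k) (u k j)

attribute [instance] CompactMatrixQuantumGroup.cstar CompactMatrixQuantumGroup.fintype
  CompactMatrixQuantumGroup.decEq

/-- Two compact quantum groups are isomorphic if there is a *-isomorphism between their function
algebras that intertwines the comultiplications. -/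
def CompactMatrixQuantumGroup.Isomorphic (G H : CompactMatrixQuantumGroup.{u}) : Prop :=
  ∃ φ : G.Alg ≃⋆ₐ[ℂ] H.Alg, ∀ a : G.Alg,
    H.Δ (φ a) = MinTensor.map (φ : G.Alg →⋆ₐ[ℂ] H.Alg) (φ : G.Alg →⋆ₐ[ℂ] H.Alg) (G.Δ a)

section Qut

variable {V : Type u} [Fintype V]

variable {K : Type v} {X : SimpleGraph V} {c : V → K} in
open Classical in
theorem IsQuantumAut.isUnit {A : Type*} [CStarAlgebra A] {w : V → V → A}
    (hw : IsQuantumAut X c w) : IsUnit (Matrix.of w) := by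
  refine ⟨⟨Matrix.of w, (Matrix.of w).transpose, ?_, ?_⟩, rfl⟩
  · ext i j
    rw [Matrix.mul_apply, Matrix.one_apply]
    simp only [Matrix.transpose_apply, Matrix.of_apply]
    split_ifs with h
    · subst h; simp only [hw.idempotent, hw.row_sum]
    · exact Finset.sum_eq_zero fun k _ => projections_orthogonal (q := fun i => w i k)
        (fun i => hw.selfAdjoint i k) (fun i => hw.idempotent i k) (hw.col_sum k) h
  · ext i j
    rw [Matrix.mul_apply, Matrix.one_apply]
    simp only [Matrix.transpose_apply, Matrix.of_apply]
    split_ifs with h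
    · subst h; simp only [hw.idempotent, hw.col_sum]
    · exact Finset.sum_eq_zero fun k _ => projections_orthogonal (hw.selfAdjoint k)
        (hw.idempotent k) (hw.row_sum k) h

open Classical in
/-- The quantum automorphism group `Qut_c(X)` of a graph `X` with vertex coloring `c`. -/
noncomputable def QutColored {K : Type v} (X : SimpleGraph V) (c : V → K) :
    CompactMatrixQuantumGroup.{u} where
  Alg := QutAlgebra X c
  Index := V
  u := Matrix.of (QutAlgebra.u X c)
  dense := QutAlgebra.adjoin_u_dense X c
  isUnit_u := (QutAlgebra.isQuantumAut_u X c).isUnit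
  isUnit_u_star := by
    convert (QutAlgebra.isQuantumAut_u X c).isUnit using 1
    ext i j
    exact (QutAlgebra.isQuantumAut_u X c).selfAdjoint i j
  Δ := QutAlgebra.lift (QutAlgebra.isQuantumAut_u X c).tensor
  Δ_u i j := QutAlgebra.lift_u _ i j

/-- The quantum automorphism group `Qut(X)` of an uncolored graph: all vertices get the same
color. -/
noncomputable def Qut (X : SimpleGraph V) : CompactMatrixQuantumGroup.{u} :=
  QutColored X (fun _ => ())

/-- The quantum automorphism group `Qut_r(T)` of a graph `T` with root `r`: the root gets one color
and all other vertices get another one. -/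
noncomputable def QutRooted (T : SimpleGraph V) (r : V) : CompactMatrixQuantumGroup.{u} :=
  QutColored T (fun x => x = r)

end Qut

/-! ### Rooted paths and the construction of the unrooted tree -/

section Trees

/-- The rooted graph `(T, r)` is a path rooted at one of its endpoints (the one-vertex graph
included). -/
def IsPathRootedAtEnd {V : Type u} (T : SimpleGraph V) (r : V) : Prop :=
  ∃ (n : ℕ) (e : T ≃g SimpleGraph.pathGraph (n + 1)), e r = 0

/-- The graph obtained from the disjoint union of two rooted graphs `(T, r)` and `(P, s)` by adding
a new vertex `none`, adjacent to `r` and `s` only. -/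
def joinRoots {V : Type u} {W : Type v} (T : SimpleGraph V) (r : V) (P : SimpleGraph W) (s : W) :
    SimpleGraph (Option (V ⊕ W)) where
  Adj
    | some (Sum.inl a), some (Sum.inl b) => T.Adj a b
    | some (Sum.inr a), some (Sum.inr b) => P.Adj a b
    | none, some (Sum.inl a) => a = r
    | some (Sum.inl a), none => a = r
    | none, some (Sum.inr a) => a = s
    | some (Sum.inr a), none => a = s
    | _, _ => False
  symm := ⟨by
    rintro (_ | a | a) (_ | b | b) h
    all_goals first | exact h | exact T.adj_symm h | exact P.adj_symm h⟩
  loopless := ⟨by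
    rintro (_ | a | a) h
    · exact h
    · exact T.irrefl h
    · exact P.irrefl h⟩

/-- The graph obtained from the rooted graph `(T, r)` and a path with `2 * |V(T)|` edges, rooted at
one of its endpoints, by adding a new vertex adjacent to the two roots only. -/
def attachLongPath {V : Type u} [Fintype V] (T : SimpleGraph V) (r : V) :
    SimpleGraph (Option (V ⊕ Fin (2 * Fintype.card V + 1))) :=
  joinRoots T r (SimpleGraph.pathGraph (2 * Fintype.card V + 1)) 0

end Trees

/-!
A quantum automorphism preserves distances: `w i j * w k l = 0` unless `dist i k = dist j l`. Hence
if `w x y ≠ 0` and the sphere of radius `m` around `x` has at most one vertex, then so has the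
sphere of radius `m` around `y`. In the graph obtained from `(T, r)` by attaching a path with `n`
edges through a new vertex, the spheres of radius at most `n + 2` around the far end of the path
have at most one vertex; if `(T, r)` is not a path rooted at its end and `|V(T)| ≤ n + 2`, no other
vertex has this property. So the far end is fixed and, by distances from it, so is every vertex
outside `T`. Since `r` is the only neighbour in `T` of the new vertex, fixing the new vertex forces
the rooted coloring on `T`, and it follows that restriction to `T` and extension by the identity
are mutually inverse.

For a path rooted at its end, the root is fixed by its color and distances to the root separate
vertices, so every vertex is fixed.
-/

/-! ### Distances -/

section Distance

variable {V W : Type*} {G : SimpleGraph V} {H : SimpleGraph W} {a b c : V}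

theorem dist_eq_of_forall_adj {h : V → ℕ} (h_zero : ∀ b, h b = 0 ↔ b = a)
    (h_adj : ∀ b c, G.Adj b c → h c ≤ h b + 1)
    (h_succ : ∀ b m, h b = m + 1 → ∃ c, G.Adj c b ∧ h c = m) (b : V) : G.dist a b = h b := by
  have exists_walk : ∀ m b, h b = m → ∃ p : G.Walk a b, p.length = m := by
    intro m
    induction m with
    | zero =>
      intro b hb
      obtain rfl := (h_zero b).1 hb
      exact ⟨.nil, rfl⟩
    | succ m ih =>
      intro b hb
      obtain ⟨c, hcb, hc⟩ := h_succ b m hb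
      obtain ⟨p, hp⟩ := ih c hc
      exact ⟨p.concat hcb, by rw [SimpleGraph.Walk.length_concat, hp]⟩
  have le_add_length : ∀ {x y} (p : G.Walk x y), h y ≤ h x + p.length := by
    intro x y p
    induction p with
    | nil => exact le_rfl
    | cons hxy p ih =>
      have := h_adj _ _ hxy
      rw [SimpleGraph.Walk.length_cons]
      omega
  obtain ⟨p, hp⟩ := exists_walk _ b rfl
  obtain ⟨q, hq⟩ := p.reachable.exists_walk_length_eq_dist
  refine le_antisymm (hp ▸ SimpleGraph.dist_le p) ?_
  simpa only [(h_zero a).2 rfl, zero_add, hq] using le_add_length q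

theorem exists_adj_dist_eq (hG : G.Connected) {m : ℕ} (h : G.dist a b = m + 1) :
    ∃ c, G.Adj c b ∧ G.dist a c = m := by
  obtain ⟨p, hp⟩ := hG.exists_walk_length_eq_dist b a
  rw [SimpleGraph.dist_comm, h] at hp
  cases p with
  | nil => exact absurd hp (Nat.succ_ne_zero m).symm
  | @cons _ c _ hbc p =>
    have hle : G.dist c a ≤ m :=
      (SimpleGraph.dist_le p).trans (Nat.succ_le_succ_iff.1 hp.le)
    have hge := hG.dist_triangle (u := a) (v := c) (w := b)
    rw [h, SimpleGraph.dist_eq_one_iff_adj.2 hbc.symm] at hge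
    rw [SimpleGraph.dist_comm] at hle
    exact ⟨c, hbc.symm, by omega⟩

theorem dist_le_dist_add_one_of_adj (hG : G.Connected) (a : V) (h : G.Adj b c) :
    G.dist a c ≤ G.dist a b + 1 :=
  SimpleGraph.dist_eq_one_iff_adj.2 h ▸ hG.dist_triangle

theorem dist_lt_card [Fintype V] (hG : G.Connected) (a b : V) : G.dist a b < Fintype.card V := by
  obtain ⟨p, hp, h⟩ := hG.exists_path_of_dist a b
  exact h ▸ hp.length_lt

theorem edist_map_le (f : G →g H) (a b : V) : H.edist (f a) (f b) ≤ G.edist a b :=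
  le_iInf fun p => (SimpleGraph.edist_le (p.map f)).trans_eq (by rw [SimpleGraph.Walk.length_map])

theorem dist_map_iso (e : G ≃g H) (a b : V) : H.dist (e a) (e b) = G.dist a b := by
  refine congrArg ENat.toNat (le_antisymm (edist_map_le e.toHom a b) ?_)
  simpa using edist_map_le e.symm.toHom (e a) (e b)

theorem isTree_of_ncard_edgeSet_lt [Finite V] (hG : G.Connected)
    (h : G.edgeSet.ncard < Nat.card V) : G.IsTree :=
  SimpleGraph.isTree_iff_connected_and_card.2
    ⟨hG, le_antisymm h hG.card_vert_le_card_edgeSet_add_one⟩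

end Distance

section PathGraph

open SimpleGraph (pathGraph)

theorem isTree_pathGraph (n : ℕ) : (pathGraph (n + 1)).IsTree := by
  have hsub : (pathGraph (n + 1)).edgeSet ⊆ Set.range fun i : Fin n => s(i.castSucc, i.succ) := by
    intro e
    induction e with | _ a b
    rw [SimpleGraph.mem_edgeSet, SimpleGraph.pathGraph_adj]
    rintro (h | h)
    · exact ⟨⟨a, by omega⟩, Sym2.eq_iff.2 (.inl ⟨rfl, Fin.ext h⟩)⟩
    · exact ⟨⟨b, by omega⟩, Sym2.eq_iff.2 (.inr ⟨rfl, Fin.ext h⟩)⟩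
  refine isTree_of_ncard_edgeSet_lt (SimpleGraph.pathGraph_connected n) ?_
  calc (pathGraph (n + 1)).edgeSet.ncard
      ≤ (Set.univ : Set (Fin n)).ncard := by
        rw [← Set.image_univ] at hsub
        exact (Set.ncard_le_ncard hsub).trans (Set.ncard_image_le Set.finite_univ)
    _ < Nat.card (Fin (n + 1)) := by simp [Set.ncard_univ]

theorem dist_pathGraph_zero {n : ℕ} (i : Fin (n + 1)) : (pathGraph (n + 1)).dist 0 i = i := by
  refine dist_eq_of_forall_adj (h := Fin.val) (fun i => Fin.val_eq_zero_iff)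
    (fun i j h => ?_) (fun i m h => ⟨⟨m, by omega⟩, ?_, rfl⟩) i
  · have := SimpleGraph.pathGraph_adj.1 h
    omega
  · exact SimpleGraph.pathGraph_adj.2 (.inl h.symm)

/-- The reversal automorphism `i ↦ n - 1 - i` of the path with `n` vertices. -/
def pathGraphRev (n : ℕ) : pathGraph n ≃g pathGraph n where
  toEquiv := Fin.revPerm
  map_rel_iff' {i j} := by
    simp only [Fin.revPerm_apply, SimpleGraph.pathGraph_adj, Fin.val_rev]
    omega

theorem pathGraphRev_last (n : ℕ) : pathGraphRev (n + 1) (Fin.last n) = 0 :=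
  Fin.rev_last n

theorem dist_pathGraph_last {n : ℕ} (i : Fin (n + 1)) :
    (pathGraph (n + 1)).dist (Fin.last n) i = n - i := by
  rw [← dist_map_iso (pathGraphRev (n + 1)), pathGraphRev_last, dist_pathGraph_zero]
  exact (Fin.val_rev i).trans (by omega)

end PathGraph

section IsPathRootedAtEnd

variable {V : Type u} {G : SimpleGraph V} {a r : V}

theorem dist_eq_of_iso_pathGraph {n : ℕ} {e : G ≃g SimpleGraph.pathGraph (n + 1)} (he : e r = 0)
    (b : V) : G.dist r b = e b := by
  rw [← dist_map_iso e, he, dist_pathGraph_zero]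

theorem IsPathRootedAtEnd.dist_injective (h : IsPathRootedAtEnd G r) :
    Function.Injective (G.dist r) := by
  obtain ⟨n, e, he⟩ := h
  intro b c hbc
  rw [dist_eq_of_iso_pathGraph he, dist_eq_of_iso_pathGraph he] at hbc
  exact e.injective (Fin.ext hbc)

theorem adj_iff_of_dist_injective (hG : G.Connected) (hinj : Function.Injective (G.dist a))
    {b c : V} : G.Adj b c ↔ G.dist a b + 1 = G.dist a c ∨ G.dist a c + 1 = G.dist a b := by
  have adj_of_succ : ∀ {b c}, G.dist a b + 1 = G.dist a c → G.Adj b c := fun h => by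
    obtain ⟨d, hd, hd'⟩ := exists_adj_dist_eq hG h.symm
    rwa [← hinj hd']
  refine ⟨fun h => ?_, fun h => h.elim adj_of_succ fun h => (adj_of_succ h).symm⟩
  have hle := dist_le_dist_add_one_of_adj hG a h
  have hge := dist_le_dist_add_one_of_adj hG a h.symm
  have hne := hinj.ne h.ne
  omega

theorem isPathRootedAtEnd_of_dist_injective [Finite V] (hG : G.Connected)
    (hinj : Function.Injective (G.dist a)) : IsPathRootedAtEnd G a := by
  have := Fintype.ofFinite V
  obtain ⟨n, hn⟩ := Nat.exists_eq_succ_of_ne_zero (Fintype.card_pos_iff.2 ⟨a⟩).ne'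
  let f : V → Fin (n + 1) := fun b => ⟨G.dist a b, (dist_lt_card hG a b).trans_eq hn⟩
  have hf : Function.Bijective f := by
    refine (Fintype.bijective_iff_injective_and_card f).2 ⟨fun b c h => hinj ?_, ?_⟩
    · exact congrArg Fin.val h
    · rw [hn, Fintype.card_fin]
  refine ⟨n, ⟨.ofBijective f hf, ?_⟩, Fin.ext SimpleGraph.dist_self⟩
  intro b c
  exact SimpleGraph.pathGraph_adj.trans (adj_iff_of_dist_injective hG hinj).symm

theorem IsPathRootedAtEnd.of_forall_dist_ne (h : IsPathRootedAtEnd G a)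
    (hr : ∀ b, G.dist a b ≠ G.dist a r + 1) : IsPathRootedAtEnd G r := by
  obtain ⟨n, e, he⟩ := h
  have hlast : e r = Fin.last n := by
    by_contra hne
    refine hr (e.symm ⟨e r + 1, by have := Fin.val_lt_last hne; omega⟩) ?_
    rw [dist_eq_of_iso_pathGraph he, dist_eq_of_iso_pathGraph he, RelIso.apply_symm_apply]
  exact ⟨n, e.trans (pathGraphRev (n + 1)), by
    rw [RelIso.trans_apply, hlast, pathGraphRev_last]⟩

end IsPathRootedAtEnd

/-! ### Joining rooted graphs -/

namespace joinRoots

variable {V : Type u} {W : Type v} {T : SimpleGraph V} {r : V} {P : SimpleGraph W} {s : W}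

/-- The embedding of `T` as an induced subgraph of `joinRoots T r P s`. -/
def inl (T : SimpleGraph V) (r : V) (P : SimpleGraph W) (s : W) : T ↪g joinRoots T r P s where
  toFun a := some (.inl a)
  inj' _ _ h := Sum.inl_injective (Option.some_injective _ h)
  map_rel_iff' := Iff.rfl

/-- Exchanging the roles of the two rooted graphs. -/
def swap (T : SimpleGraph V) (r : V) (P : SimpleGraph W) (s : W) :
    joinRoots T r P s ≃g joinRoots P s T r where
  toEquiv := (Equiv.sumComm V W).optionCongr
  map_rel_iff' := by rintro (_ | a | a) (_ | b | b) <;> rfl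

theorem connected (hT : T.Connected) (hP : P.Connected) : (joinRoots T r P s).Connected := by
  have reachable_inl : ∀ a, (joinRoots T r P s).Reachable none (some (.inl a)) := fun a =>
    have hr : (joinRoots T r P s).Adj none (inl T r P s r) := rfl
    hr.reachable.trans ((hT r a).map (inl T r P s).toHom)
  have reachable_inr : ∀ b, (joinRoots T r P s).Reachable none (some (.inr b)) := fun b =>
    have hs : (joinRoots T r P s).Adj none ((swap P s T r) (inl P s T r s)) := rfl
    hs.reachable.trans ((hP s b).map ((swap P s T r).toHom.comp (inl P s T r).toHom))
  refine SimpleGraph.connected_iff_exists_forall_reachable _ |>.2 ⟨none, ?_⟩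
  rintro (_ | a | b)
  exacts [.refl _, reachable_inl a, reachable_inr b]

theorem edgeSet_subset : (joinRoots T r P s).edgeSet ⊆
    Sym2.map (some ∘ Sum.inl) '' T.edgeSet ∪ Sym2.map (some ∘ Sum.inr) '' P.edgeSet ∪
      {s(none, some (.inl r)), s(none, some (.inr s))} := by
  intro e
  induction e with | _ x y
  rw [SimpleGraph.mem_edgeSet]
  rcases x with _ | a | a <;> rcases y with _ | b | b <;> intro h
  · exact h.elim
  · obtain rfl := h
    exact .inr (.inl rfl)
  · obtain rfl := h
    exact .inr (.inr rfl)
  · obtain rfl := h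
    exact .inr (.inl Sym2.eq_swap)
  · exact .inl (.inl ⟨s(a, b), h, rfl⟩)
  · exact h.elim
  · obtain rfl := h
    exact .inr (.inr Sym2.eq_swap)
  · exact h.elim
  · exact .inl (.inr ⟨s(a, b), h, rfl⟩)

theorem isTree [Finite V] [Finite W] (hT : T.IsTree) (hP : P.IsTree) :
    (joinRoots T r P s).IsTree := by
  have hVT : T.edgeSet.ncard + 1 = Nat.card V :=
    (SimpleGraph.isTree_iff_connected_and_card.1 hT).2
  have hWP : P.edgeSet.ncard + 1 = Nat.card W :=
    (SimpleGraph.isTree_iff_connected_and_card.1 hP).2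
  refine isTree_of_ncard_edgeSet_lt (connected hT.connected hP.connected) ?_
  calc (joinRoots T r P s).edgeSet.ncard
      ≤ T.edgeSet.ncard + P.edgeSet.ncard + 2 := by
        refine (Set.ncard_le_ncard edgeSet_subset).trans ((Set.ncard_union_le _ _).trans ?_)
        refine Nat.add_le_add ((Set.ncard_union_le _ _).trans ?_) ?_
        · exact Nat.add_le_add (Set.ncard_image_le T.edgeSet.toFinite)
            (Set.ncard_image_le P.edgeSet.toFinite)
        · exact (Set.ncard_insert_le _ _).trans_eq (by rw [Set.ncard_singleton])
    _ < Nat.card V + Nat.card W + 1 := by omega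
    _ = Nat.card (Option (V ⊕ W)) := by rw [Finite.card_option, Nat.card_sum]

theorem dist_inl (hT : T.Connected) (hP : P.Connected) (v : V) (x : Option (V ⊕ W)) :
    (joinRoots T r P s).dist (some (.inl v)) x =
      x.elim (T.dist v r + 1) (Sum.elim (T.dist v) fun b => T.dist v r + 2 + P.dist s b) := by
  refine dist_eq_of_forall_adj
    (h := fun x => x.elim (T.dist v r + 1)
      (Sum.elim (T.dist v) fun b => T.dist v r + 2 + P.dist s b)) ?_ ?_ ?_ x
  · rintro (_ | a | b)
    · simp
    · simp [hT.dist_eq_zero_iff, eq_comm]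
    · simp
  · rintro (_ | a | b) (_ | a' | b') h
    · exact h.elim
    · obtain rfl := h
      exact (Nat.le_succ _).trans (Nat.le_succ _)
    · obtain rfl := h
      simp
    · obtain rfl := h
      exact le_rfl
    · exact dist_le_dist_add_one_of_adj hT v h
    · exact h.elim
    · obtain rfl := h
      simp
    · exact h.elim
    · exact Nat.add_le_add_left (dist_le_dist_add_one_of_adj hP s h) _
  · rintro (_ | a | b) m h
    · exact ⟨some (.inl r), rfl, Nat.succ_injective h⟩
    · obtain ⟨c, hc, hm⟩ := exists_adj_dist_eq hT h
      exact ⟨some (.inl c), hc, hm⟩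
    · rcases Nat.eq_zero_or_pos (P.dist s b) with hb | hb
      · obtain rfl := hP.dist_eq_zero_iff.1 hb
        simp only [Option.elim_some, Sum.elim_inr, hb] at h
        exact ⟨none, rfl, Nat.succ_injective h⟩
      · obtain ⟨c, hc, hm⟩ := exists_adj_dist_eq hP (Nat.sub_add_cancel hb).symm
        refine ⟨some (.inr c), hc, ?_⟩
        simp only [Option.elim_some, Sum.elim_inr] at h ⊢
        omega

theorem dist_inr (hT : T.Connected) (hP : P.Connected) (w : W) (x : Option (V ⊕ W)) :
    (joinRoots T r P s).dist (some (.inr w)) x =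
      x.elim (P.dist w s + 1) (Sum.elim (fun a => P.dist w s + 2 + T.dist r a) (P.dist w)) := by
  rw [← dist_map_iso (swap T r P s)]
  rcases x with _ | a | b <;> exact dist_inl hP hT w _

end joinRoots

/-- The graph obtained from `(T, r)` and a path with `n` edges by adding a new vertex adjacent to
`r` and to one endpoint of the path; `attachLongPath T r` is `attachPath T r (2 * |V(T)|)`. -/
def attachPath {V : Type u} (T : SimpleGraph V) (r : V) (n : ℕ) :
    SimpleGraph (Option (V ⊕ Fin (n + 1))) :=
  joinRoots T r (SimpleGraph.pathGraph (n + 1)) 0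

namespace attachPath

variable {V : Type u} {T : SimpleGraph V} {r : V} {n : ℕ}

theorem connected (hT : T.Connected) : (attachPath T r n).Connected :=
  joinRoots.connected hT (SimpleGraph.pathGraph_connected n)

theorem isTree [Finite V] (hT : T.IsTree) : (attachPath T r n).IsTree :=
  joinRoots.isTree hT (isTree_pathGraph n)

/-- The embedding of `T` as an induced subgraph of `attachPath T r n`. -/
def inl (T : SimpleGraph V) (r : V) (n : ℕ) : T ↪g attachPath T r n :=
  joinRoots.inl T r (SimpleGraph.pathGraph (n + 1)) 0

/-- The endpoint of the attached path that is farther from `T`. -/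
def tip (V : Type u) (n : ℕ) : Option (V ⊕ Fin (n + 1)) :=
  some (.inr (Fin.last n))

theorem dist_inl_inl (hT : T.Connected) (a b : V) :
    (attachPath T r n).dist (inl T r n a) (inl T r n b) = T.dist a b :=
  joinRoots.dist_inl hT (SimpleGraph.pathGraph_connected n) a _

theorem dist_inl_none (hT : T.Connected) (a : V) :
    (attachPath T r n).dist (inl T r n a) none = T.dist a r + 1 :=
  joinRoots.dist_inl hT (SimpleGraph.pathGraph_connected n) a _

theorem dist_tip_none (hT : T.Connected) : (attachPath T r n).dist (tip V n) none = n + 1 :=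
  (joinRoots.dist_inr hT (SimpleGraph.pathGraph_connected n) _ _).trans
    (by simp [dist_pathGraph_last])

theorem dist_tip_inl (hT : T.Connected) (a : V) :
    (attachPath T r n).dist (tip V n) (some (.inl a)) = n + 2 + T.dist r a :=
  (joinRoots.dist_inr hT (SimpleGraph.pathGraph_connected n) _ _).trans
    (by simp [dist_pathGraph_last])

theorem dist_tip_inr (hT : T.Connected) (i : Fin (n + 1)) :
    (attachPath T r n).dist (tip V n) (some (.inr i)) = n - i :=
  (joinRoots.dist_inr hT (SimpleGraph.pathGraph_connected n) _ _).trans (dist_pathGraph_last i)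

theorem dist_tip_le_of_notMem_range_inl (hT : T.Connected) {x : Option (V ⊕ Fin (n + 1))}
    (hx : x ∉ Set.range (inl T r n)) : (attachPath T r n).dist (tip V n) x ≤ n + 1 := by
  rcases x with _ | a | i
  · exact (dist_tip_none hT).le
  · exact absurd ⟨a, rfl⟩ hx
  · rw [dist_tip_inr hT]
    omega

theorem sphere_tip_subsingleton (hT : T.Connected) {m : ℕ} (hm : m ≤ n + 2) :
    {x | (attachPath T r n).dist (tip V n) x = m}.Subsingleton := by
  have eq_root : ∀ {a}, n + 2 + T.dist r a = m → r = a := fun h =>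
    hT.dist_eq_zero_iff.1 (by omega)
  rintro (_ | a | i) hx (_ | b | j) hy <;>
    simp only [Set.mem_ofPred_eq, dist_tip_none hT, dist_tip_inl hT, dist_tip_inr hT] at hx hy
  any_goals omega
  · rfl
  · rw [← eq_root hx, ← eq_root hy]
  · rw [Fin.ext (show (i : ℕ) = j by omega)]

/-- Distances within `T` are less than `|V(T)| ≤ n + 2`, so these radii reach every vertex of `T`
and the new vertex. -/
theorem isPathRootedAtEnd_of_sphere_inl_subsingleton [Fintype V] (hT : T.Connected)
    (hn : Fintype.card V ≤ n + 2) {v : V}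
    (h : ∀ m ≤ n + 2, {x | (attachPath T r n).dist (inl T r n v) x = m}.Subsingleton) :
    IsPathRootedAtEnd T r := by
  have hlt := dist_lt_card hT v
  refine (isPathRootedAtEnd_of_dist_injective hT (a := v) fun a b hab => ?_).of_forall_dist_ne
    fun b hb => ?_
  · refine (inl T r n).injective (h (T.dist v b) (by have := hlt b; omega) ?_ ?_)
    · exact (dist_inl_inl hT v a).trans hab
    · exact dist_inl_inl hT v b
  · have : inl T r n b = none := h (T.dist v r + 1) (by have := hlt r; omega)
      ((dist_inl_inl hT v b).trans hb) (dist_inl_none hT v)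
    exact Option.some_ne_none _ this

theorem not_neighborSet_none_subsingleton :
    ¬((attachPath T r n).neighborSet none).Subsingleton := fun h => by
  have : inl T r n r = some (.inr 0) := h rfl rfl
  exact Sum.inl_ne_inr (Option.some_injective _ this)

theorem eq_last_of_neighborSet_inr_subsingleton {i : Fin (n + 1)}
    (h : ((attachPath T r n).neighborSet (some (.inr i))).Subsingleton) : i = Fin.last n := by
  by_contra hi
  have hin : i + 1 < n + 1 := by have := Fin.val_lt_last hi; omega
  have hsucc : some (.inr ⟨i + 1, hin⟩) ∈ (attachPath T r n).neighborSet (some (.inr i)) :=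
    SimpleGraph.pathGraph_adj.2 (.inl rfl)
  rcases Nat.eq_zero_or_pos i with h0 | hpos
  · have hnone : none ∈ (attachPath T r n).neighborSet (some (.inr i)) := Fin.ext h0
    exact Option.some_ne_none _ (h hsucc hnone)
  · have hpred :
        some (.inr ⟨i - 1, by omega⟩) ∈ (attachPath T r n).neighborSet (some (.inr i)) :=
      SimpleGraph.pathGraph_adj.2 (.inr (Nat.sub_add_cancel hpos))
    have := Fin.ext_iff.1 (Sum.inr_injective (Option.some_injective _ (h hsucc hpred)))
    dsimp only at this
    omega

theorem eq_tip_of_sphere_subsingleton [Fintype V] (hT : T.Connected)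
    (hn : Fintype.card V ≤ n + 2) (hr : ¬IsPathRootedAtEnd T r) {y : Option (V ⊕ Fin (n + 1))}
    (h : ∀ m ≤ n + 2, {x | (attachPath T r n).dist y x = m}.Subsingleton) : y = tip V n := by
  have hnbr : ((attachPath T r n).neighborSet y).Subsingleton := fun a ha b hb =>
    h 1 (by omega) (SimpleGraph.dist_eq_one_iff_adj.2 ha) (SimpleGraph.dist_eq_one_iff_adj.2 hb)
  rcases y with _ | v | i
  · exact absurd hnbr not_neighborSet_none_subsingleton
  · exact absurd (isPathRootedAtEnd_of_sphere_inl_subsingleton hT hn h) hr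
  · rw [eq_last_of_neighborSet_inr_subsingleton hnbr, tip]

end attachPath

/-! ### Quantum automorphisms -/

namespace IsQuantumAut

variable {V : Type*} [Fintype V] {K : Type*} {X : SimpleGraph V} {c : V → K} {A : Type*}
  {w : V → V → A}

section Ring

variable [Ring A] [StarRing A]

theorem transpose (hw : IsQuantumAut X c w) : IsQuantumAut X c fun i j => w j i where
  selfAdjoint i j := hw.selfAdjoint j i
  idempotent i j := hw.idempotent j i
  row_sum i := hw.col_sum i
  col_sum j := hw.row_sum j
  edge i j k l h := hw.edge j i l k (by tauto)
  color i j h := hw.color j i h.symm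

theorem apply_self_eq_one (hw : IsQuantumAut X c w) {i : V} (h : ∀ j ≠ i, w i j = 0) :
    w i i = 1 := by
  rw [← hw.row_sum i, Fintype.sum_eq_single i h]

theorem apply_eq_zero_of_not_adj_iff_adj (hw : IsQuantumAut X c w) {x i j : V} (hx : w x x = 1)
    (h : ¬(X.Adj x i ↔ X.Adj x j)) : w i j = 0 := by
  rw [← one_mul (w i j), ← hx, hw.edge x x i j (by tauto)]

end Ring

variable [CStarAlgebra A]

theorem mul_eq_zero_of_ne (hw : IsQuantumAut X c w) (i : V) {j k : V} (h : j ≠ k) :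
    w i j * w i k = 0 :=
  projections_orthogonal (hw.selfAdjoint i) (hw.idempotent i) (hw.row_sum i) h

theorem mul_eq_zero_of_length_lt_edist (hw : IsQuantumAut X c w) {i k : V} (p : X.Walk i k)
    (j l : V) (h : p.length < X.edist j l) : w i j * w k l = 0 := by
  induction p generalizing j with
  | nil => exact hw.mul_eq_zero_of_ne _ fun hjl => by simp [hjl] at h
  | @cons i m k him p ih =>
    calc w i j * w k l = ∑ n, w i j * w m n * w k l := by
          rw [← Finset.sum_mul, ← Finset.mul_sum, hw.row_sum, mul_one]
      _ = 0 := Finset.sum_eq_zero fun n _ => ?_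
    by_cases hjn : X.Adj j n
    · have hlt : p.length < X.edist n l := by
        by_contra! hle
        refine h.not_ge ((X.edist_triangle (v := n)).trans ?_)
        rw [SimpleGraph.edist_eq_one_iff_adj.2 hjn, SimpleGraph.Walk.length_cons, Nat.cast_add,
          Nat.cast_one, add_comm]
        gcongr
      rw [mul_assoc, ih n hlt, mul_zero]
    · rw [hw.edge i j m n (.inl ⟨him, hjn⟩), zero_mul]

theorem mul_eq_zero_of_edist_lt (hw : IsQuantumAut X c w) {i j k l : V}
    (h : X.edist i k < X.edist j l) : w i j * w k l = 0 := by
  obtain ⟨p, hp⟩ := SimpleGraph.exists_walk_of_edist_ne_top h.ne_top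
  exact hw.mul_eq_zero_of_length_lt_edist p j l (hp ▸ h)

theorem mul_eq_zero_of_dist_ne (hw : IsQuantumAut X c w) {i j k l : V}
    (h : X.dist i k ≠ X.dist j l) : w i j * w k l = 0 := by
  have hne : X.edist i k ≠ X.edist j l := fun h' => h (congrArg ENat.toNat h')
  rcases hne.lt_or_gt with h | h
  · exact hw.mul_eq_zero_of_edist_lt h
  · exact hw.transpose.mul_eq_zero_of_edist_lt h

theorem exists_mul_eq_self (hw : IsQuantumAut X c w) {x y : V} (hxy : w x y ≠ 0) {m : ℕ}
    (hx : {i | X.dist x i = m}.Subsingleton) {k : V} (hk : X.dist y k = m) :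
    ∃ i, X.dist x i = m ∧ w x y * w i k = w x y := by
  have hsum : ∑ i, w x y * w i k = w x y := by rw [← Finset.mul_sum, hw.col_sum, mul_one]
  obtain ⟨i, -, hi⟩ := Finset.exists_ne_zero_of_sum_ne_zero (hsum.trans_ne hxy)
  have hdist : ∀ i, w x y * w i k ≠ 0 → X.dist x i = m := fun i hi =>
    by_contra fun h => hi (hw.mul_eq_zero_of_dist_ne (hk ▸ h))
  refine ⟨i, hdist i hi, ?_⟩
  rwa [Fintype.sum_eq_single i fun i' hne => ?_] at hsum
  by_contra hi'
  exact hne (hx (hdist i' hi') (hdist i hi))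

theorem sphere_subsingleton (hw : IsQuantumAut X c w) {x y : V} (hxy : w x y ≠ 0) {m : ℕ}
    (hx : {i | X.dist x i = m}.Subsingleton) : {k | X.dist y k = m}.Subsingleton := by
  intro k hk l hl
  obtain ⟨i, hi, hik⟩ := hw.exists_mul_eq_self hxy hx hk
  obtain ⟨i', hi', hil⟩ := hw.exists_mul_eq_self hxy hx hl
  obtain rfl := hx hi hi'
  by_contra hkl
  exact hxy (by rw [← hil, ← hik, mul_assoc, hw.mul_eq_zero_of_ne i hkl, mul_zero])

theorem apply_eq_zero_of_left_fixed (hw : IsQuantumAut X c w) {x y : V} (hx : w x x = 1)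
    (hxy : y ≠ x) : w x y = 0 := by
  rw [← one_mul (w x y), ← hx, hw.mul_eq_zero_of_ne x hxy.symm]

theorem apply_eq_zero_of_right_fixed (hw : IsQuantumAut X c w) {x y : V} (hy : w y y = 1)
    (hxy : x ≠ y) : w x y = 0 :=
  hw.transpose.apply_eq_zero_of_left_fixed hy hxy

theorem apply_self_eq_one_of_sphere_subsingleton (hw : IsQuantumAut X c w) {a x : V}
    (ha : w a a = 1) (hx : {y | X.dist a y = X.dist a x}.Subsingleton) : w x x = 1 := by
  refine hw.apply_self_eq_one fun y hy => ?_
  have hdist : X.dist a x ≠ X.dist a y := fun h => hy (hx h.symm rfl)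
  rw [← one_mul (w x y), ← ha, hw.mul_eq_zero_of_dist_ne hdist]

end IsQuantumAut

/-! ### Isomorphisms of quantum automorphism groups -/

namespace MinTensor

variable {A B C D E F : Type u} [CStarAlgebra A] [CStarAlgebra B] [CStarAlgebra C] [CStarAlgebra D]
  [CStarAlgebra E] [CStarAlgebra F]

open scoped CStarAlgebra in
theorem hom_ext {f g : MinTensor A B →⋆ₐ[ℂ] C} (h : ∀ a b, f (tmul a b) = g (tmul a b)) :
    f = g := by
  refine StarAlgHom.ext fun x => CStarSeminorm.compl_induction _ (C := fun x => f x = g x) x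
    (isClosed_eq (map_continuous f) (map_continuous g)) fun x => ?_
  change f ((minNorm A B).ι x) = g ((minNorm A B).ι x)
  induction x using TensorProduct.induction_on with
  | zero => simp only [map_zero]
  | add x y hx hy => simp only [map_add, hx, hy]
  | tmul a b => exact h a b

theorem map_comp_map (φ' : C →⋆ₐ[ℂ] E) (ψ' : D →⋆ₐ[ℂ] F) (φ : A →⋆ₐ[ℂ] C) (ψ : B →⋆ₐ[ℂ] D) :
    (map φ' ψ').comp (map φ ψ) = map (φ'.comp φ) (ψ'.comp ψ) :=
  hom_ext fun a b => by simp only [StarAlgHom.comp_apply, map_tmul]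

theorem map_id : map (.id ℂ A) (.id ℂ B) = .id ℂ (MinTensor A B) :=
  hom_ext fun a b => by simp only [StarAlgHom.coe_id, id, map_tmul]

end MinTensor

theorem CompactMatrixQuantumGroup.Isomorphic.symm {G H : CompactMatrixQuantumGroup.{u}}
    (h : G.Isomorphic H) : H.Isomorphic G := by
  obtain ⟨φ, hφ⟩ := h
  refine ⟨φ.symm, fun a => ?_⟩
  have hinv : (φ.symm : H.Alg →⋆ₐ[ℂ] G.Alg).comp (φ : G.Alg →⋆ₐ[ℂ] H.Alg) = .id ℂ _ :=
    StarAlgHom.ext φ.symm_apply_apply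
  have hΔ := hφ (φ.symm a)
  rw [StarAlgEquiv.apply_symm_apply] at hΔ
  rw [hΔ, ← StarAlgHom.comp_apply, MinTensor.map_comp_map, hinv, MinTensor.map_id,
    StarAlgHom.coe_id, id]

open scoped CStarAlgebra in
theorem QutAlgebra.hom_ext {V : Type u} [Fintype V] {K : Type*} {X : SimpleGraph V} {c : V → K}
    {B : Type*} [CStarAlgebra B] {f g : QutAlgebra X c →⋆ₐ[ℂ] B}
    (h : ∀ i j, f (QutAlgebra.u X c i j) = g (QutAlgebra.u X c i j)) : f = g := by
  have hclosed : IsClosed (StarAlgHom.equalizer f g : Set (QutAlgebra X c)) :=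
    isClosed_eq (map_continuous f) (map_continuous g)
  have hgen : StarAlgebra.adjoin ℂ {a | ∃ i j, a = QutAlgebra.u X c i j} ≤
      StarAlgHom.equalizer f g :=
    StarAlgHom.adjoin_le_equalizer f g (by rintro _ ⟨i, j, rfl⟩; exact h i j)
  have hle := StarSubalgebra.topologicalClosure_minimal hgen hclosed
  rw [QutAlgebra.adjoin_u_dense] at hle
  exact StarAlgHom.ext fun x => hle StarSubalgebra.mem_top

section IsomorphicOfFixes

variable {V W : Type*}

open Classical in
/-- The extension of the matrix `w` along the injection `e` by an identity matrix on the complement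
of the range of `e`. -/
noncomputable def extendByOne {A : Type*} [Zero A] [One A] (e : V → W) (w : V → V → A) (x y : W) :
    A :=
  Function.extend (Prod.map e e) (fun p => w p.1 p.2) (fun p => if p.1 = p.2 then 1 else 0) (x, y)

section ExtendByOne

variable {A : Type*} [Zero A] [One A] {e : V → W} {w : V → V → A} {x y : W}

theorem extendByOne_apply (he : Function.Injective e) (a b : V) :
    extendByOne e w (e a) (e b) = w a b :=
  (he.prodMap he).extend_apply _ _ (a, b)

open Classical in
theorem extendByOne_of_notMem_range (h : x ∉ Set.range e ∨ y ∉ Set.range e) :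
    extendByOne e w x y = if x = y then 1 else 0 := by
  refine Function.extend_apply' _ _ _ ?_
  rintro ⟨⟨a, b⟩, hab⟩
  simp only [Prod.map_apply, Prod.mk.injEq] at hab
  exact h.elim (fun h => h ⟨a, hab.1⟩) fun h => h ⟨b, hab.2⟩

theorem extendByOne_self_of_notMem_range (h : x ∉ Set.range e) : extendByOne e w x x = 1 :=
  (extendByOne_of_notMem_range (.inl h)).trans (if_pos rfl)

theorem extendByOne_of_notMem_range_of_ne (h : x ∉ Set.range e ∨ y ∉ Set.range e) (hxy : x ≠ y) :
    extendByOne e w x y = 0 :=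
  (extendByOne_of_notMem_range h).trans (if_neg hxy)

theorem extendByOne_cases (e : V → W) (w : V → V → A) (x y : W) :
    (∃ a b, x = e a ∧ y = e b) ∨ (x ∉ Set.range e ∧ x = y) ∨ extendByOne e w x y = 0 := by
  by_cases h : x ∉ Set.range e ∨ y ∉ Set.range e
  · rcases eq_or_ne x y with rfl | hxy
    · exact .inr (.inl ⟨by simpa using h, rfl⟩)
    · exact .inr (.inr (extendByOne_of_notMem_range_of_ne h hxy))
  · push Not at h
    obtain ⟨⟨a, rfl⟩, b, rfl⟩ := h
    exact .inl ⟨a, b, rfl, rfl⟩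

open Classical in
theorem extendByOne_swap (he : Function.Injective e) (x y : W) :
    extendByOne e (fun a b => w b a) x y = extendByOne e w y x := by
  by_cases h : x ∉ Set.range e ∨ y ∉ Set.range e
  · rw [extendByOne_of_notMem_range h, extendByOne_of_notMem_range h.symm]
    exact if_congr eq_comm rfl rfl
  · push Not at h
    obtain ⟨⟨a, rfl⟩, b, rfl⟩ := h
    rw [extendByOne_apply he, extendByOne_apply he]

theorem map_extendByOne {B F : Type*} [Zero B] [One B] [FunLike F A B] [ZeroHomClass F A B]
    [OneHomClass F A B] (f : F) (he : Function.Injective e) (x y : W) :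
    f (extendByOne e w x y) = extendByOne e (fun a b => f (w a b)) x y := by
  by_cases h : x ∉ Set.range e ∨ y ∉ Set.range e
  · rw [extendByOne_of_notMem_range h, extendByOne_of_notMem_range h, apply_ite f, map_one,
      map_zero]
  · push Not at h
    obtain ⟨⟨a, rfl⟩, b, rfl⟩ := h
    rw [extendByOne_apply he, extendByOne_apply he]

end ExtendByOne

theorem sum_extendByOne [Fintype V] [Fintype W] {A : Type*} [AddCommMonoidWithOne A] {e : V → W}
    (he : Function.Injective e) {w : V → V → A} (hw : ∀ a, ∑ b, w a b = 1) (x : W) :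
    ∑ y, extendByOne e w x y = 1 := by
  by_cases hx : x ∈ Set.range e
  · obtain ⟨a, rfl⟩ := hx
    rw [← hw a]
    exact (Fintype.sum_of_injective e he _ _
      (fun y hy => extendByOne_of_notMem_range_of_ne (.inr hy) fun h => hy ⟨a, h⟩)
      fun b => (extendByOne_apply he a b).symm).symm
  · rw [Fintype.sum_eq_single x fun y hy => extendByOne_of_notMem_range_of_ne (.inl hx) hy.symm,
      extendByOne_self_of_notMem_range hx]

variable [Fintype W] {K L : Type*} {X : SimpleGraph V} {Y : SimpleGraph W} {c : V → K} {d : W → L}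

theorem IsQuantumAut.extendByOne_restrict {A : Type*} [CStarAlgebra A] {w : W → W → A}
    (hw : IsQuantumAut Y d w) {e : V → W} (he : Function.Injective e)
    (hfix : ∀ x ∉ Set.range e, w x x = 1) (x y : W) :
    extendByOne e (fun a b => w (e a) (e b)) x y = w x y := by
  by_cases h : x ∉ Set.range e ∨ y ∉ Set.range e
  · rcases eq_or_ne x y with rfl | hxy
    · have hx : x ∉ Set.range e := h.elim id id
      rw [extendByOne_self_of_notMem_range hx, hfix x hx]
    · rw [extendByOne_of_notMem_range_of_ne h hxy]
      rcases h with hx | hy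
      · exact (hw.apply_eq_zero_of_left_fixed (hfix x hx) hxy.symm).symm
      · exact (hw.apply_eq_zero_of_right_fixed (hfix y hy) hxy).symm
  · push Not at h
    obtain ⟨⟨a, rfl⟩, b, rfl⟩ := h
    exact extendByOne_apply he a b

variable [Fintype V]

theorem IsQuantumAut.extendByOne {A : Type*} [Ring A] [StarRing A] {w : V → V → A}
    (hw : IsQuantumAut X c w) (e : X ↪g Y) (hd : ∀ a b, c a = c b → d (e a) = d (e b))
    (hadj : ∀ a b, c a = c b → ∀ x ∉ Set.range e, (Y.Adj (e a) x ↔ Y.Adj (e b) x)) :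
    IsQuantumAut Y d (extendByOne e w) where
  selfAdjoint x y := by
    rcases extendByOne_cases e w x y with ⟨a, b, rfl, rfl⟩ | ⟨hx, rfl⟩ | h
    · rw [extendByOne_apply e.injective, hw.selfAdjoint]
    · rw [extendByOne_self_of_notMem_range hx, star_one]
    · rw [h, star_zero]
  idempotent x y := by
    rcases extendByOne_cases e w x y with ⟨a, b, rfl, rfl⟩ | ⟨hx, rfl⟩ | h
    · rw [extendByOne_apply e.injective, hw.idempotent]
    · rw [extendByOne_self_of_notMem_range hx, one_mul]
    · rw [h, zero_mul]
  row_sum := sum_extendByOne e.injective hw.row_sum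
  col_sum y := (Fintype.sum_congr _ _ fun x => (extendByOne_swap e.injective y x).symm).trans
    (sum_extendByOne e.injective hw.col_sum y)
  edge x y x' y' h := by
    have hcolor : ∀ {a b}, w a b ≠ 0 → c a = c b := fun hab =>
      by_contra fun h => hab (hw.color _ _ h)
    by_contra h0
    have h1 := left_ne_zero_of_mul h0
    have h2 := right_ne_zero_of_mul h0
    rcases (extendByOne_cases e w x y).imp_right (·.resolve_right h1) with
        ⟨a, b, rfl, rfl⟩ | ⟨hx, rfl⟩ <;>
      rcases (extendByOne_cases e w x' y').imp_right (·.resolve_right h2) with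
        ⟨a', b', rfl, rfl⟩ | ⟨hx', rfl⟩
    · rw [extendByOne_apply e.injective, extendByOne_apply e.injective] at h0
      simp only [e.map_adj_iff] at h
      exact h0 (hw.edge a b a' b' h)
    · rw [extendByOne_apply e.injective] at h1
      have := hadj a b (hcolor h1) x' hx'
      tauto
    · rw [extendByOne_apply e.injective] at h2
      have := hadj a' b' (hcolor h2) x hx
      rw [Y.adj_comm x, Y.adj_comm x] at h
      tauto
    · tauto
  color x y h := by
    rcases extendByOne_cases e w x y with ⟨a, b, rfl, rfl⟩ | ⟨-, rfl⟩ | h'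
    · rw [extendByOne_apply e.injective]
      exact hw.color a b fun hab => h (hd a b hab)
    · exact absurd rfl h
    · exact h'

theorem IsQuantumAut.restrict {A : Type*} [CStarAlgebra A] {w : W → W → A}
    (hw : IsQuantumAut Y d w) (e : X ↪g Y) (hfix : ∀ x ∉ Set.range e, w x x = 1)
    (hcol : ∀ a b, c a ≠ c b → w (e a) (e b) = 0) :
    IsQuantumAut X c fun a b => w (e a) (e b) where
  selfAdjoint a b := hw.selfAdjoint _ _
  idempotent a b := hw.idempotent _ _
  row_sum a := by
    rw [← hw.row_sum (e a)]
    exact Fintype.sum_of_injective e e.injective _ _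
      (fun x hx => hw.apply_eq_zero_of_right_fixed (hfix x hx) fun h => hx ⟨a, h⟩) fun _ => rfl
  col_sum b := by
    rw [← hw.col_sum (e b)]
    exact Fintype.sum_of_injective e e.injective _ _
      (fun x hx => hw.apply_eq_zero_of_left_fixed (hfix x hx) fun h => hx ⟨b, h⟩) fun _ => rfl
  edge a b a' b' h := hw.edge _ _ _ _ (by simpa only [e.map_adj_iff] using h)
  color := hcol

end IsomorphicOfFixes

theorem QutColored.isomorphic_of_fixes_compl_range {V W : Type u} [Fintype V] [Fintype W]
    {K L : Type*} {X : SimpleGraph V} {Y : SimpleGraph W} {c : V → K} {d : W → L} (e : X ↪g Y)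
    (hd : ∀ a b, c a = c b → d (e a) = d (e b))
    (hadj : ∀ a b, c a = c b → ∀ x ∉ Set.range e, (Y.Adj (e a) x ↔ Y.Adj (e b) x))
    (hfix : ∀ x ∉ Set.range e, QutAlgebra.u Y d x x = 1)
    (hcol : ∀ a b, c a ≠ c b → QutAlgebra.u Y d (e a) (e b) = 0) :
    (QutColored X c).Isomorphic (QutColored Y d) := by
  have hY := QutAlgebra.isQuantumAut_u Y d
  have hX := QutAlgebra.isQuantumAut_u X c
  let restrict := QutAlgebra.lift (hY.restrict e hfix hcol)
  let extend := QutAlgebra.lift (hX.extendByOne e hd hadj)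
  have hextend : extend.comp restrict = .id ℂ _ :=
    QutAlgebra.hom_ext fun a b => by
      rw [StarAlgHom.comp_apply, QutAlgebra.lift_u, QutAlgebra.lift_u,
        extendByOne_apply e.injective, StarAlgHom.coe_id, id]
  have hrestrict : restrict.comp extend = .id ℂ _ :=
    QutAlgebra.hom_ext fun x y => by
      rw [StarAlgHom.comp_apply, QutAlgebra.lift_u, map_extendByOne restrict e.injective]
      simp only [restrict, QutAlgebra.lift_u, hY.extendByOne_restrict e.injective hfix,
        StarAlgHom.coe_id, id]
  have hΔ : (QutAlgebra.lift hY.tensor).comp restrict =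
      (MinTensor.map restrict restrict).comp (QutAlgebra.lift hX.tensor) :=
    QutAlgebra.hom_ext fun a b => by
      simp only [StarAlgHom.comp_apply, QutAlgebra.lift_u, restrict, map_sum, MinTensor.map_tmul]
      refine (Fintype.sum_of_injective e e.injective _ _ (fun x hx => ?_) fun _ => rfl).symm
      rw [hY.apply_eq_zero_of_right_fixed (hfix x hx) fun h => hx ⟨a, h⟩]
      simp only [MinTensor.tmul, TensorProduct.zero_tmul, map_zero]
  exact ⟨StarAlgEquiv.ofStarAlgHom restrict extend hextend hrestrict, DFunLike.congr_fun hΔ⟩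

section AttachPath

variable {V : Type u} [Fintype V] {T : SimpleGraph V} {r : V} {n : ℕ}

namespace IsQuantumAut

variable {K : Type*} {c : Option (V ⊕ Fin (n + 1)) → K} {A : Type*} [CStarAlgebra A]
  {w : Option (V ⊕ Fin (n + 1)) → Option (V ⊕ Fin (n + 1)) → A}

theorem apply_tip_tip (hw : IsQuantumAut (attachPath T r n) c w) (hT : T.Connected)
    (hn : Fintype.card V ≤ n + 2) (hr : ¬IsPathRootedAtEnd T r) :
    w (attachPath.tip V n) (attachPath.tip V n) = 1 := by
  refine hw.apply_self_eq_one fun y hy => by_contra fun hne => hy ?_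
  exact attachPath.eq_tip_of_sphere_subsingleton hT hn hr fun m hm =>
    hw.sphere_subsingleton hne (attachPath.sphere_tip_subsingleton hT hm)

theorem apply_self_eq_one_of_notMem_range_inl (hw : IsQuantumAut (attachPath T r n) c w)
    (hT : T.Connected) (hn : Fintype.card V ≤ n + 2) (hr : ¬IsPathRootedAtEnd T r)
    {x : Option (V ⊕ Fin (n + 1))} (hx : x ∉ Set.range (attachPath.inl T r n)) : w x x = 1 :=
  hw.apply_self_eq_one_of_sphere_subsingleton (hw.apply_tip_tip hT hn hr)
    (attachPath.sphere_tip_subsingleton hT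
      ((attachPath.dist_tip_le_of_notMem_range_inl hT hx).trans (Nat.le_succ _)))

end IsQuantumAut

theorem qut_attachPath_isomorphic_qutRooted (hT : T.Connected) (hn : Fintype.card V ≤ n + 2)
    (hr : ¬IsPathRootedAtEnd T r) : (Qut (attachPath T r n)).Isomorphic (QutRooted T r) := by
  have hu := QutAlgebra.isQuantumAut_u (attachPath T r n) fun _ => ()
  have hfix : ∀ x ∉ Set.range (attachPath.inl T r n), QutAlgebra.u (attachPath T r n) _ x x = 1 :=
    fun x hx => hu.apply_self_eq_one_of_notMem_range_inl hT hn hr hx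
  refine (QutColored.isomorphic_of_fixes_compl_range (attachPath.inl T r n) (fun _ _ _ => rfl)
    ?_ hfix fun a b hab => ?_).symm
  · rintro a b hab (_ | v | i) hx
    · exact iff_of_eq hab
    · exact absurd ⟨v, rfl⟩ hx
    · exact Iff.rfl
  · have hnone : none ∉ Set.range (attachPath.inl T r n) := fun ⟨a, ha⟩ =>
      Option.some_ne_none _ ha
    exact hu.apply_eq_zero_of_not_adj_iff_adj (hfix none hnone) fun h => hab (propext h)

end AttachPath

theorem qut_punit_isomorphic_qutRooted {V : Type u} [Fintype V] {T : SimpleGraph V} {r : V}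
    (h : IsPathRootedAtEnd T r) :
    (Qut (⊥ : SimpleGraph PUnit.{u + 1})).Isomorphic (QutRooted T r) := by
  have hu := QutAlgebra.isQuantumAut_u T fun x => x = r
  have hroot : QutAlgebra.u T (fun x => x = r) r r = 1 :=
    hu.apply_self_eq_one fun j hj => hu.color r j fun hc => hj (hc.mp rfl)
  have hfix : ∀ x, QutAlgebra.u T (fun x => x = r) x x = 1 := fun x =>
    hu.apply_self_eq_one_of_sphere_subsingleton hroot fun y hy z hz =>
      h.dist_injective (hy.trans hz.symm)
  let root : (⊥ : SimpleGraph PUnit.{u + 1}) ↪g T :=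
    { toFun := fun _ => r
      inj' := Function.injective_of_subsingleton _
      map_rel_iff' := iff_of_false T.irrefl not_false }
  exact QutColored.isomorphic_of_fixes_compl_range root (fun _ _ _ => rfl)
    (fun _ _ _ _ _ => Iff.rfl) (fun x _ => hfix x) fun a b hab => absurd rfl hab

theorem mainTheorem6_general {V : Type u} [Fintype V] {T : SimpleGraph V} {r : V}
    (hT : T.Connected) {n : ℕ} (hn : Fintype.card V ≤ n + 2) :
    (∃ (W : Type u) (_ : Fintype W) (T' : SimpleGraph W),
      T'.Connected ∧ (T.IsTree → T'.IsTree) ∧ (Qut T').Isomorphic (QutRooted T r)) ∧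
    (IsPathRootedAtEnd T r →
      (Qut (⊥ : SimpleGraph PUnit.{u + 1})).Isomorphic (QutRooted T r)) ∧
    (¬ IsPathRootedAtEnd T r →
      (attachPath T r n).Connected ∧ (T.IsTree → (attachPath T r n).IsTree) ∧
        (Qut (attachPath T r n)).Isomorphic (QutRooted T r)) := by
  have hpath (hr : ¬IsPathRootedAtEnd T r) :
      (attachPath T r n).Connected ∧ (T.IsTree → (attachPath T r n).IsTree) ∧
        (Qut (attachPath T r n)).Isomorphic (QutRooted T r) :=
    ⟨attachPath.connected hT, attachPath.isTree, qut_attachPath_isomorphic_qutRooted hT hn hr⟩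
  refine ⟨?_, qut_punit_isomorphic_qutRooted, hpath⟩
  by_cases hr : IsPathRootedAtEnd T r
  · have hpunit : (⊥ : SimpleGraph PUnit.{u + 1}).IsTree := .of_subsingleton
    exact ⟨PUnit, inferInstance, ⊥, hpunit.connected, fun _ => hpunit,
      qut_punit_isomorphic_qutRooted hr⟩
  · exact ⟨_, inferInstance, attachPath T r n, hpath hr⟩

theorem mainTheorem6 {V : Type u} [Fintype V] (T : SimpleGraph V) (r : V) (hT : T.IsTree) :
    (∃ (W : Type u) (_ : Fintype W) (T' : SimpleGraph W),
      T'.IsTree ∧ (Qut T').Isomorphic (QutRooted T r)) ∧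
    (IsPathRootedAtEnd T r →
      (Qut (⊥ : SimpleGraph PUnit.{u + 1})).Isomorphic (QutRooted T r)) ∧
    (¬ IsPathRootedAtEnd T r →
      (attachLongPath T r).IsTree ∧
        (Qut (attachLongPath T r)).Isomorphic (QutRooted T r)) := by
  have ⟨⟨W, hW, T', _, hT', hiso⟩, hpath, hnot⟩ := mainTheorem6_general (T := T) (r := r)
    hT.connected (n := 2 * Fintype.card V) (by omega)
  exact ⟨⟨W, hW, T', hT' hT, hiso⟩, hpath, fun hr => (hnot hr).2.imp_left (· hT)⟩
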